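/- An instance of the fair allocation problem with $n \ge 1$ agents and $m \ge 0$ indivisible goods consists of the set of agents $N = \{1,\dots,n\}$, the set of goods $M = \{1,\dots,m\}$ and, for every agent $i \in N$, an additive valuation $v_i : 2^M \to \mathbb{R}$, that is, $v_i(S) = \sum_{g \in S} v_i(\{g\})$ for all $S \subseteq M$, with $v_i(\{g\}) \ge 0$ for all $g \in M$. An allocation is a partition $A = \langle A_1, \dots, A_n\rangle$ of $M$ into $n$ (possibly empty) bundles, where agent $i$ receives $A_i$. The maximin share of agent $i$ is \[ \mu_i = \max_{A} \min_{1 \le j \le n} v_i(A_j), \] where the maximum is over all allocations $A$. An MMS allocation is an allocation $A$ with $v_i(A_i) \ge \mu_i$ for every agent $i \in N$. Theorem. Every instance with $n \ge 1$ agents, $n \neq 3$, and $m \le n + 6$ goods has an MMS allocation. -/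

import Mathlib

/-- An instance of the fair allocation problem with agents `Fin n` and items `Fin m`:
every agent has an additive valuation on the bundles (sets) of items. -/
structure FairInstance (n m : ℕ) where
  /-- `val i S` is the value of the bundle `S` for agent `i`. -/
  val : Fin n → Finset (Fin m) → ℝ
  /-- Valuations are additive; in particular the empty bundle has value `0`. -/
  additive : ∀ (i : Fin n) (S : Finset (Fin m)), val i S = ∑ g ∈ S, val i {g}

/-- An allocation: a partition of the items into `n` (possibly empty) bundles,
`A i` being the bundle of agent `i`. -/
structure IsAllocation {n m : ℕ} (A : Fin n → Finset (Fin m)) : Prop where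
  disjoint : ∀ i j : Fin n, i ≠ j → Disjoint (A i) (A j)
  covers : ∀ g : Fin m, ∃ i : Fin n, g ∈ A i

namespace FairInstance

/-- All items are goods: no agent assigns a negative value to any item. -/
def IsGoods {n m : ℕ} (I : FairInstance n m) : Prop :=
  ∀ (i : Fin n) (g : Fin m), 0 ≤ I.val i {g}

/-- The maximin share of agent `i`: the maximum over all allocations of the minimum value
(for `i`) of a bundle. There are finitely many allocations, and at least one as soon as there
is an agent, so that both the supremum and the infimum are attained. -/
noncomputable def mms {n m : ℕ} (I : FairInstance n m) (i : Fin n) : ℝ :=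
  ⨆ A : {A : Fin n → Finset (Fin m) // IsAllocation A}, ⨅ j : Fin n, I.val i (A.1 j)

/-- `A` is an MMS allocation: an allocation in which every agent receives a bundle that is
worth at least her maximin share to her. -/
def IsMMSAllocation {n m : ℕ} (I : FairInstance n m) (A : Fin n → Finset (Fin m)) : Prop :=
  IsAllocation A ∧ ∀ i : Fin n, I.mms i ≤ I.val i (A i)

end FairInstance

/-! Goods are renamed by rank, so that all agents share one preference order (a smaller index is a
better good), and values are scaled so that every maximin share becomes `1`. A picking sequence
carries allocations back to the original instance. Each of `n` agents then has a packing of `n`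
disjoint bundles worth at least `1`, and the task is to serve all of them.

Call a bundle harmless to an agent if removing it costs her packing only one bundle. Single goods
are harmless; so is a pair the agent rejects (value below `1`), and so is a bundle dominated good by
good by a bundle of her packing. Giving an agent a bundle she accepts that is harmless to all others
reduces `n` by one.

For `n ≥ 4` the proof is by induction. If one good satisfies an agent, she takes it. Otherwise all
packed bundles have at least two goods and counting gives at least `2n - 6` pairs per agent;
`CanAllocate.of_forall_lt_one` finds a pair that is harmless to everyone but its receiver. This
saves one more good than needed, so four agents reduce to three agents with at most eight goods.
There every unsatisfied agent owns a pair, and two pair owners suffice (`CanAllocate.of_ownsPair`).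

The delicate case is four agents with a satisfying single good, which leaves three agents and up to
nine goods (`CanAllocate.of_four_of_single`). If pair owners are scarce, three agents partition nine
goods into triples, and two such partitions always contain comparable triples
(`exists_dominatesTriple`). -/

/-! ### Packings, and bundles whose removal costs one packed bundle. -/

/-- `Q` consists of `k` pairwise disjoint bundles inside `H`, each worth at least `1` under `u`. -/
structure IsPacking (u : ℕ → ℝ) (k : ℕ) (H : Finset ℕ) (Q : Finset (Finset ℕ)) : Prop where
  card_eq : Q.card = k
  disj : ∀ D ∈ Q, ∀ E ∈ Q, D ≠ E → Disjoint D E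
  subset : ∀ D ∈ Q, D ⊆ H
  worth : ∀ D ∈ Q, 1 ≤ ∑ g ∈ D, u g

/-- The goods of `H` contain `k` pairwise disjoint bundles worth at least `1`. -/
def HasPacking (u : ℕ → ℝ) (k : ℕ) (H : Finset ℕ) : Prop := ∃ Q, IsPacking u k H Q

/-- The agents of `N` can be given pairwise disjoint bundles of `H`, each worth at least `1` to
its owner. -/
def CanAllocate {ι : Type*} (u : ι → ℕ → ℝ) (N : Finset ι) (H : Finset ℕ) : Prop :=
  ∃ A : ι → Finset ℕ, (∀ i ∈ N, A i ⊆ H ∧ 1 ≤ ∑ g ∈ A i, u i g) ∧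
    ∀ i ∈ N, ∀ j ∈ N, i ≠ j → Disjoint (A i) (A j)

namespace IsPacking

variable {u : ℕ → ℝ} {k : ℕ} {H : Finset ℕ} {Q : Finset (Finset ℕ)}

lemma nonempty (h : IsPacking u k H Q) {D : Finset ℕ} (hD : D ∈ Q) : D.Nonempty := by
  rw [Finset.nonempty_iff_ne_empty]
  rintro rfl
  have := h.worth _ hD
  simp at this
  linarith

lemma eq_of_mem (h : IsPacking u k H Q) {D E : Finset ℕ} (hD : D ∈ Q) (hE : E ∈ Q) {g : ℕ}
    (hgD : g ∈ D) (hgE : g ∈ E) : D = E := by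
  by_contra hne
  exact Finset.disjoint_left.1 (h.disj D hD E hE hne) hgD hgE

lemma erase (h : IsPacking u (k + 1) H Q) {C : Finset ℕ} (hC : C ∈ Q) :
    IsPacking u k (H \ C) (Q.erase C) where
  card_eq := by rw [Finset.card_erase_of_mem hC, h.card_eq]; rfl
  disj D hD E hE := h.disj D (Finset.mem_of_mem_erase hD) E (Finset.mem_of_mem_erase hE)
  subset D hD := by
    rw [Finset.subset_sdiff]
    exact ⟨h.subset D (Finset.mem_of_mem_erase hD),
      h.disj D (Finset.mem_of_mem_erase hD) C hC (Finset.ne_of_mem_erase hD)⟩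
  worth D hD := h.worth D (Finset.mem_of_mem_erase hD)

lemma mono (h : IsPacking u k H Q) {H' : Finset ℕ} (hH : H ⊆ H') : IsPacking u k H' Q :=
  ⟨h.card_eq, h.disj, fun D hD => (h.subset D hD).trans hH, h.worth⟩

lemma sum_card_le (h : IsPacking u k H Q) : ∑ D ∈ Q, D.card ≤ H.card := by
  rw [← Finset.card_biUnion (fun D hD E hE => h.disj D hD E hE)]
  exact Finset.card_le_card (Finset.biUnion_subset.2 h.subset)

lemma le_sum (hu : ∀ g, 0 ≤ u g) (h : IsPacking u k H Q) : (k : ℝ) ≤ ∑ g ∈ H, u g := by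
  have h1 : ∑ g ∈ Q.biUnion id, u g ≤ ∑ g ∈ H, u g :=
    Finset.sum_le_sum_of_subset_of_nonneg (Finset.biUnion_subset.2 h.subset) fun g _ _ => hu g
  rw [Finset.sum_biUnion (t := id) (fun D hD E hE => h.disj D hD E hE)] at h1
  have h2 : ∑ D ∈ Q, (1 : ℝ) ≤ ∑ D ∈ Q, ∑ g ∈ id D, u g := Finset.sum_le_sum h.worth
  simp only [Finset.sum_const, h.card_eq, nsmul_eq_mul, mul_one] at h2
  linarith

end IsPacking

namespace HasPacking

variable {u : ℕ → ℝ} {k : ℕ} {H : Finset ℕ}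

lemma mono (h : HasPacking u k H) {H' : Finset ℕ} (hH : H ⊆ H') : HasPacking u k H' :=
  h.imp fun _ hQ => hQ.mono hH

lemma le_sum (hu : ∀ g, 0 ≤ u g) (h : HasPacking u k H) : (k : ℝ) ≤ ∑ g ∈ H, u g :=
  h.elim fun _ hQ => hQ.le_sum hu

/-- Enlarging one bundle by all unused goods gives a packing that covers `H`. -/
lemma exists_covering (hu : ∀ g, 0 ≤ u g) (h : HasPacking u (k + 1) H) :
    ∃ Q, IsPacking u (k + 1) H Q ∧ ∀ g ∈ H, ∃ D ∈ Q, g ∈ D := by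
  obtain ⟨Q, hQ⟩ := h
  obtain ⟨C, hC⟩ : Q.Nonempty := Finset.card_pos.1 (by rw [hQ.card_eq]; omega)
  have hE := hQ.erase hC
  set C' := H \ (Q.erase C).biUnion id with hC'
  have hCC : C ⊆ C' := by
    intro g hg
    simp only [hC', Finset.mem_sdiff, Finset.mem_biUnion, id, not_exists, not_and]
    exact ⟨hQ.subset C hC hg, fun D hD hgD => (Finset.mem_sdiff.1 (hE.subset D hD hgD)).2 hg⟩
  have hdis : ∀ D ∈ Q.erase C, Disjoint C' D := by
    intro D hD
    rw [Finset.disjoint_left]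
    intro g hg hgD
    exact (Finset.mem_sdiff.1 hg).2 (Finset.mem_biUnion.2 ⟨D, hD, hgD⟩)
  have hnot : C' ∉ Q.erase C := by
    intro hmem
    obtain ⟨g, hg⟩ := hQ.nonempty hC
    exact Finset.disjoint_left.1 (hdis _ hmem) (hCC hg) (hCC hg)
  refine ⟨insert C' (Q.erase C), ⟨?_, ?_, ?_, ?_⟩, ?_⟩
  · rw [Finset.card_insert_of_notMem hnot, hE.card_eq]
  · intro D hD E hE' hne
    rcases Finset.mem_insert.1 hD with rfl | hD <;> rcases Finset.mem_insert.1 hE' with rfl | hE'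
    · exact absurd rfl hne
    · exact hdis E hE'
    · exact (hdis D hD).symm
    · exact hE.disj D hD E hE' hne
  · intro D hD
    rcases Finset.mem_insert.1 hD with rfl | hD
    · exact Finset.sdiff_subset
    · exact (hE.subset D hD).trans Finset.sdiff_subset
  · intro D hD
    rcases Finset.mem_insert.1 hD with rfl | hD
    · exact (hQ.worth C hC).trans
        (Finset.sum_le_sum_of_subset_of_nonneg hCC fun g _ _ => hu g)
    · exact hE.worth D hD
  · intro g hg
    by_cases hgC : g ∈ C'
    · exact ⟨C', Finset.mem_insert_self _ _, hgC⟩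
    · simp only [hC', Finset.mem_sdiff, not_and, not_not] at hgC
      obtain ⟨D, hD, hgD⟩ := Finset.mem_biUnion.1 (hgC hg)
      exact ⟨D, Finset.mem_insert_of_mem hD, hgD⟩

/-- Exchanging a removed good for a worse one. -/
lemma swap {C : Finset ℕ} {b c : ℕ} (h : HasPacking u k (H \ C)) (hc : c ∈ C) (hcH : c ∈ H)
    (hbc : u b ≤ u c) : HasPacking u k (H \ insert b (C.erase c)) := by
  by_cases hb : b ∈ H \ C
  swap
  · refine h.mono fun g hg => ?_
    simp only [Finset.mem_sdiff, Finset.mem_insert, Finset.mem_erase] at hb hg ⊢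
    refine ⟨hg.1, ?_⟩
    rintro (rfl | h2)
    · exact hb hg
    · exact hg.2 h2.2
  obtain ⟨Q, hQ⟩ := h
  -- Transposing `b` and `c` gives the bundle that used `b` the better good `c`.
  set e := Equiv.swap b c with he
  have hinj : Function.Injective (fun D : Finset ℕ => D.map e.toEmbedding) :=
    Finset.map_injective _
  refine ⟨Q.image fun D => D.map e.toEmbedding, ?_, ?_, ?_, ?_⟩
  · rw [Finset.card_image_of_injective _ hinj, hQ.card_eq]
  · simp only [Finset.mem_image]
    rintro _ ⟨D, hD, rfl⟩ _ ⟨E, hE, rfl⟩ hne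
    rw [Finset.disjoint_map]
    exact hQ.disj D hD E hE fun h => hne (by rw [h])
  · simp only [Finset.mem_image]
    rintro _ ⟨D, hD, rfl⟩ g hg
    obtain ⟨x, hx, rfl⟩ := Finset.mem_map.1 hg
    have hxH := hQ.subset D hD hx
    simp only [Finset.mem_sdiff, Finset.mem_insert, Finset.mem_erase, Equiv.coe_toEmbedding] at hb hxH ⊢
    have hbc' : b ≠ c := fun h => hb.2 (h ▸ hc)
    by_cases hxb : x = b
    · subst hxb
      simp only [he, Equiv.swap_apply_left]
      exact ⟨hcH, by rintro (h | h); exacts [hbc' h.symm, h.1 rfl]⟩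
    · have hxc : x ≠ c := fun h => hxH.2 (h ▸ hc)
      rw [he, Equiv.swap_apply_of_ne_of_ne hxb hxc]
      exact ⟨hxH.1, by rintro (h | h); exacts [hxb h, hxH.2 h.2]⟩
  · simp only [Finset.mem_image]
    rintro _ ⟨D, hD, rfl⟩
    rw [Finset.sum_map]
    refine (hQ.worth D hD).trans (Finset.sum_le_sum fun x hx => ?_)
    have hxH := hQ.subset D hD hx
    have hxc : x ≠ c := fun h => (Finset.mem_sdiff.1 hxH).2 (h ▸ hc)
    by_cases hxb : x = b
    · subst hxb
      simpa [he] using hbc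
    · simp [he, Equiv.swap_apply_of_ne_of_ne hxb hxc]

lemma sdiff_singleton (h : HasPacking u (k + 1) H) (g : ℕ) : HasPacking u k (H \ {g}) := by
  obtain ⟨Q, hQ⟩ := h
  by_cases hg : ∃ D ∈ Q, g ∈ D
  · obtain ⟨D, hD, hgD⟩ := hg
    exact ⟨_, (hQ.erase hD).mono (Finset.sdiff_subset_sdiff le_rfl (by simpa using hgD))⟩
  · push Not at hg
    obtain ⟨C, hC⟩ : Q.Nonempty := Finset.card_pos.1 (by rw [hQ.card_eq]; omega)
    refine ⟨Q.erase C, (hQ.erase hC).card_eq, (hQ.erase hC).disj, fun D hD => ?_,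
      (hQ.erase hC).worth⟩
    have hD' := Finset.mem_of_mem_erase hD
    rw [Finset.subset_sdiff, Finset.disjoint_singleton_right]
    exact ⟨hQ.subset D hD', hg D hD'⟩

/-- A pair of goods that is not worth `1` can be removed at the cost of a single bundle: the
remainders of the two bundles that it meets are together worth at least `1`. -/
lemma sdiff_pair_of_lt (h : HasPacking u (k + 1) H) {x y : ℕ} (hxy : x ≠ y)
    (hlt : u x + u y < 1) : HasPacking u k (H \ {x, y}) := by
  obtain ⟨Q, hQ⟩ := h
  by_cases hdist : ∃ D ∈ Q, ∃ E ∈ Q, D ≠ E ∧ x ∈ D ∧ y ∈ E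
  · obtain ⟨D, hD, E, hE, hne, hxD, hyE⟩ := hdist
    have hED : E ∈ Q.erase D := Finset.mem_erase.2 ⟨hne.symm, hE⟩
    set R := (Q.erase D).erase E with hR
    have hRQ : ∀ F ∈ R, F ∈ Q ∧ F ≠ D ∧ F ≠ E := by
      intro F hF
      simp only [hR, Finset.mem_erase] at hF
      exact ⟨hF.2.2, hF.2.1, hF.1⟩
    set M := (D ∪ E) \ {x, y} with hM
    have hDE := hQ.disj D hD E hE hne
    have hsub : ({x, y} : Finset ℕ) ⊆ D ∪ E := by
      intro g hg
      rcases Finset.mem_insert.1 hg with rfl | hg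
      · exact Finset.mem_union_left _ hxD
      · rw [Finset.mem_singleton.1 hg]; exact Finset.mem_union_right _ hyE
    have hMw : 1 ≤ ∑ g ∈ M, u g := by
      have h1 := Finset.sum_sdiff (f := u) hsub
      rw [Finset.sum_union hDE, Finset.sum_pair hxy] at h1
      have := hQ.worth D hD
      have := hQ.worth E hE
      linarith
    have hMdis : ∀ F ∈ R, Disjoint M F := by
      intro F hF
      obtain ⟨h1, h2, h3⟩ := hRQ F hF
      refine Finset.disjoint_of_subset_left Finset.sdiff_subset ?_
      rw [Finset.disjoint_union_left]
      exact ⟨hQ.disj D hD F h1 h2.symm, hQ.disj E hE F h1 h3.symm⟩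
    have hMne : M.Nonempty := by
      rw [Finset.nonempty_iff_ne_empty]
      intro h0
      rw [h0] at hMw
      simp at hMw
      linarith
    have hMR : M ∉ R := by
      intro hmem
      obtain ⟨g, hg⟩ := hMne
      exact Finset.disjoint_left.1 (hMdis _ hmem) hg hg
    refine ⟨insert M R, ?_, ?_, ?_, ?_⟩
    · rw [Finset.card_insert_of_notMem hMR, hR, Finset.card_erase_of_mem hED,
        Finset.card_erase_of_mem hD, hQ.card_eq]
      have : 1 < Q.card := Finset.one_lt_card.2 ⟨D, hD, E, hE, hne⟩
      rw [hQ.card_eq] at this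
      omega
    · intro F hF G hG hFG
      rcases Finset.mem_insert.1 hF with rfl | hF <;> rcases Finset.mem_insert.1 hG with rfl | hG
      · exact absurd rfl hFG
      · exact hMdis G hG
      · exact (hMdis F hF).symm
      · exact hQ.disj F (hRQ F hF).1 G (hRQ G hG).1 hFG
    · intro F hF
      rcases Finset.mem_insert.1 hF with rfl | hF
      · exact Finset.sdiff_subset_sdiff (Finset.union_subset (hQ.subset D hD) (hQ.subset E hE))
          le_rfl
      · obtain ⟨h1, h2, h3⟩ := hRQ F hF
        rw [Finset.subset_sdiff]
        refine ⟨hQ.subset F h1, ?_⟩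
        rw [Finset.disjoint_left]
        intro g hg hg'
        rcases Finset.mem_insert.1 hg' with rfl | hg'
        · exact h2 (hQ.eq_of_mem h1 hD hg hxD)
        · rw [Finset.mem_singleton.1 hg'] at hg
          exact h3 (hQ.eq_of_mem h1 hE hg hyE)
    · intro F hF
      rcases Finset.mem_insert.1 hF with rfl | hF
      · exact hMw
      · exact hQ.worth F (hRQ F hF).1
  · push Not at hdist
    obtain ⟨C, hC, hCx⟩ : ∃ C ∈ Q, ∀ D ∈ Q, (x ∈ D ∨ y ∈ D) → D = C := by
      by_cases hx : ∃ D ∈ Q, x ∈ D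
      · obtain ⟨D, hD, hxD⟩ := hx
        refine ⟨D, hD, fun E hE h => ?_⟩
        rcases h with h | h
        · exact hQ.eq_of_mem hE hD h hxD
        · by_contra hne
          exact hdist D hD E hE (Ne.symm hne) hxD h
      · push Not at hx
        by_cases hy : ∃ D ∈ Q, y ∈ D
        · obtain ⟨D, hD, hyD⟩ := hy
          refine ⟨D, hD, fun E hE h => ?_⟩
          rcases h with h | h
          · exact absurd h (hx E hE)
          · exact hQ.eq_of_mem hE hD h hyD
        · push Not at hy
          obtain ⟨C, hC⟩ : Q.Nonempty := Finset.card_pos.1 (by rw [hQ.card_eq]; omega)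
          refine ⟨C, hC, fun E hE h => ?_⟩
          rcases h with h | h
          · exact absurd h (hx E hE)
          · exact absurd h (hy E hE)
    refine ⟨Q.erase C, (hQ.erase hC).card_eq, (hQ.erase hC).disj, fun D hD => ?_,
      (hQ.erase hC).worth⟩
    have hD' := Finset.mem_erase.1 hD
    rw [Finset.subset_sdiff, Finset.disjoint_right]
    refine ⟨hQ.subset D hD'.2, fun g hg hgD => hD'.1 (hCx D hD'.2 ?_)⟩
    rcases Finset.mem_insert.1 hg with rfl | hg
    · exact Or.inl hgD
    · rw [Finset.mem_singleton.1 hg] at hgD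
      exact Or.inr hgD

/-- A pair can be removed if some bundle of the packing contains a pair of better goods. -/
lemma sdiff_pair_of_le (hanti : Antitone u) {Q : Finset (Finset ℕ)}
    (hQ : IsPacking u (k + 1) H Q) {C : Finset ℕ} (hC : C ∈ Q) {c d x y : ℕ} (hc : c ∈ C)
    (hd : d ∈ C) (hcd : c < d) (hxy : x < y) (hcx : c ≤ x) (hdy : d ≤ y) :
    HasPacking u k (H \ {x, y}) := by
  have h1 : HasPacking u k (H \ C) := ⟨_, hQ.erase hC⟩
  -- The order of the exchanges matters: `x` may equal `d`, and replacing `c` first would merge the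
  -- two goods.
  have h2 := h1.swap hd (hQ.subset C hC hd) (hanti hdy)
  have h3 := h2.swap (c := c) (b := x) (by simp [hc, hcd.ne]) (hQ.subset C hC hc) (hanti hcx)
  refine h3.mono fun g hg => ?_
  simp only [Finset.mem_sdiff, Finset.mem_insert, Finset.mem_erase, Finset.mem_singleton, not_or,
    not_and] at hg ⊢
  refine ⟨hg.1, hg.2.1, fun h => ?_⟩
  exact (hg.2.2 (h ▸ (hcx.trans_lt hxy).ne')).1 h

/-- A triple can be removed if the packing contains a triple of better goods. -/
lemma sdiff_triple_of_le (hanti : Antitone u) {Q : Finset (Finset ℕ)}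
    (hQ : IsPacking u (k + 1) H Q) {c₁ c₂ c₃ b₁ b₂ b₃ : ℕ} (hC : {c₁, c₂, c₃} ∈ Q)
    (hc₁ : c₁ < c₂) (hc₂ : c₂ < c₃) (hb₁ : b₁ < b₂) (hb₂ : b₂ < b₃)
    (h₁ : c₁ ≤ b₁) (h₂ : c₂ ≤ b₂) (h₃ : c₃ ≤ b₃) :
    HasPacking u k (H \ {b₁, b₂, b₃}) := by
  have hm : ∀ g ∈ ({c₁, c₂, c₃} : Finset ℕ), g ∈ H := fun g hg => hQ.subset _ hC hg
  have k1 : HasPacking u k (H \ {c₁, c₂, c₃}) := ⟨_, hQ.erase hC⟩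
  have k2 := k1.swap (c := c₃) (by simp) (hm _ (by simp)) (hanti h₃)
  have k3 := k2.swap (c := c₂) (b := b₂) (by simp [hc₂.ne]) (hm _ (by simp)) (hanti h₂)
  have k4 := k3.swap (c := c₁) (b := b₁) (by simp [hc₁.ne, (hc₁.trans hc₂).ne]) (hm _ (by simp))
    (hanti h₁)
  refine k4.mono fun g hg => ?_
  simp only [Finset.mem_sdiff, Finset.mem_insert, Finset.mem_erase, Finset.mem_singleton, not_or,
    not_and] at hg ⊢
  refine ⟨hg.1, hg.2.1, fun h => ?_, fun h => ?_⟩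
  · exact (hg.2.2 (h ▸ (h₁.trans_lt hb₁).ne')).1 h
  · exact ((hg.2.2 (h ▸ (h₁.trans_lt (hb₁.trans hb₂)).ne')).2 (h ▸ (h₂.trans_lt hb₂).ne')).1 h

end HasPacking

/-- Pigeonhole: `x`, `y` and the goods before `x` number at least `k + 2`, so two of them share one
of the `k + 1` bundles of a covering packing, and that bundle dominates `{x, y}`. -/
lemma HasPacking.sdiff_low_pair {u : ℕ → ℝ} {k : ℕ} {H : Finset ℕ} (hu : ∀ g, 0 ≤ u g)
    (hanti : Antitone u) (h : HasPacking u (k + 1) H) {x y : ℕ} (hx : x ∈ H) (hy : y ∈ H)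
    (hxy : x < y) (hk : k ≤ (H.filter (· < x)).card) : HasPacking u k (H \ {x, y}) := by
  obtain ⟨Q, hQ, hcov⟩ := h.exists_covering hu
  set E := insert y (insert x (H.filter (· < x))) with hE
  have hEH : ∀ g ∈ E, g ∈ H := by
    intro g hg
    simp only [hE, Finset.mem_insert, Finset.mem_filter] at hg
    rcases hg with rfl | rfl | hg
    exacts [hy, hx, hg.1]
  have hcard : Q.card < E.card := by
    rw [hE, Finset.card_insert_of_notMem, Finset.card_insert_of_notMem, hQ.card_eq]
    · omega
    · simp
    · simp only [Finset.mem_insert, Finset.mem_filter]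
      omega
  choose! f hfQ hf using hcov
  obtain ⟨c, hc, d, hd, hne, hcd⟩ :=
    Finset.exists_ne_map_eq_of_card_lt_of_maps_to hcard (fun g hg => hfQ g (hEH g hg))
  wlog hlt : c < d generalizing c d
  · exact this d hd c hc hne.symm hcd.symm (by omega)
  have hdf : d ∈ f c := hcd ▸ hf d (hEH d hd)
  simp only [hE, Finset.mem_insert, Finset.mem_filter] at hc hd
  exact HasPacking.sdiff_pair_of_le hanti hQ (hfQ c (hEH c (by simp [hE]; tauto)))
    (hf c (hEH c (by simp [hE]; tauto))) hdf hlt hxy (by omega) (by omega)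

/-! ### Serving two or three agents. -/

namespace CanAllocate

variable {ι : Type*} {u : ι → ℕ → ℝ} {H : Finset ℕ}

lemma empty : CanAllocate u (∅ : Finset ι) H := ⟨fun _ => ∅, by simp, by simp⟩

variable [DecidableEq ι]

lemma give {N : Finset ι} {i : ι} (hi : i ∉ N) {B : Finset ℕ} (hB : B ⊆ H)
    (hw : 1 ≤ ∑ g ∈ B, u i g) (h : CanAllocate u N (H \ B)) : CanAllocate u (insert i N) H := by
  obtain ⟨A, hA, hdis⟩ := h
  have hne : ∀ j ∈ N, j ≠ i := fun j hj h => hi (h ▸ hj)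
  have hBA : ∀ j ∈ N, Disjoint B (A j) := fun j hj =>
    (Finset.subset_sdiff.1 (hA j hj).1).2.symm
  refine ⟨Function.update A i B, fun j hj => ?_, fun j hj l hl hjl => ?_⟩
  · rcases Finset.mem_insert.1 hj with rfl | hj
    · simpa using ⟨hB, hw⟩
    · rw [Function.update_of_ne (hne j hj)]
      exact ⟨(hA j hj).1.trans Finset.sdiff_subset, (hA j hj).2⟩
  · rcases Finset.mem_insert.1 hj with h₁ | h₁ <;> rcases Finset.mem_insert.1 hl with h₂ | h₂
    · exact absurd (h₁.trans h₂.symm) hjl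
    · rw [h₁, Function.update_self, Function.update_of_ne (hne l h₂)]
      exact hBA l h₂
    · rw [h₂, Function.update_self, Function.update_of_ne (hne j h₁)]
      exact (hBA j h₁).symm
    · rw [Function.update_of_ne (hne j h₁), Function.update_of_ne (hne l h₂)]
      exact hdis j h₁ l h₂ hjl

lemma give_erase {N : Finset ι} {i : ι} (hi : i ∈ N) {B : Finset ℕ} (hB : B ⊆ H)
    (hw : 1 ≤ ∑ g ∈ B, u i g) (h : CanAllocate u (N.erase i) (H \ B)) : CanAllocate u N H := by
  rw [← Finset.insert_erase hi]
  exact give (Finset.notMem_erase i N) hB hw h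

lemma of_three {a b c : ι} (hab : a ≠ b) (hac : a ≠ c) (hbc : b ≠ c) {X Y Z : Finset ℕ}
    (hX : X ⊆ H) (hY : Y ⊆ H) (hZ : Z ⊆ H) (hXY : Disjoint X Y) (hXZ : Disjoint X Z)
    (hYZ : Disjoint Y Z) (ha : 1 ≤ ∑ g ∈ X, u a g) (hb : 1 ≤ ∑ g ∈ Y, u b g)
    (hc : 1 ≤ ∑ g ∈ Z, u c g) : CanAllocate u {a, b, c} H := by
  refine give (by simp [hab, hac]) hX ha (give (by simp [hbc])
    (Finset.subset_sdiff.2 ⟨hY, hXY.symm⟩) hb ?_)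
  rw [← insert_empty_eq c]
  exact give (by simp) (Finset.subset_sdiff.2 ⟨Finset.subset_sdiff.2 ⟨hZ, hXZ.symm⟩, hYZ.symm⟩)
    hc empty

/-- Cut and choose: `a` cuts, `b` chooses. -/
lemma of_two {a b : ι} (hab : a ≠ b) (ha : HasPacking (u a) 2 H) (hua : ∀ g, 0 ≤ u a g)
    (hb : 2 ≤ ∑ g ∈ H, u b g) : CanAllocate u {a, b} H := by
  obtain ⟨Q, hQ, hcov⟩ := ha.exists_covering hua
  obtain ⟨X, Y, hXY, hQXY⟩ := Finset.card_eq_two.1 hQ.card_eq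
  have hX : X ∈ Q := by simp [hQXY]
  have hY : Y ∈ Q := by simp [hQXY]
  have hdis := hQ.disj X hX Y hY hXY
  have hH : H = X ∪ Y := by
    apply Finset.Subset.antisymm
    · intro g hg
      obtain ⟨D, hD, hgD⟩ := hcov g hg
      rw [hQXY] at hD
      rcases Finset.mem_insert.1 hD with rfl | hD
      · exact Finset.mem_union_left _ hgD
      · rw [Finset.mem_singleton.1 hD] at hgD
        exact Finset.mem_union_right _ hgD
    · exact Finset.union_subset (hQ.subset X hX) (hQ.subset Y hY)
  have key : ∀ X Y : Finset ℕ, X ∈ Q → Y ∈ Q → Disjoint X Y → 1 ≤ ∑ g ∈ Y, u b g →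
      CanAllocate u {a, b} H := by
    intro X Y hX hY hdis hw
    refine give (by simpa using hab) (hQ.subset X hX) (hQ.worth X hX) ?_
    rw [← insert_empty_eq b]
    exact give (by simp) (Finset.subset_sdiff.2 ⟨hQ.subset Y hY, hdis.symm⟩) hw empty
  rw [hH, Finset.sum_union hdis] at hb
  by_cases hw : 1 ≤ ∑ g ∈ Y, u b g
  · exact key X Y hX hY hdis hw
  · exact key Y X hY hX hdis.symm (by linarith)

/-- If removing a bundle acceptable to `a` is harmless for both `a` and `b`, then three agents
can be served. -/
lemma of_common_bundle {a b c : ι} (hu : ∀ i g, 0 ≤ u i g) (hab : a ≠ b) (hac : a ≠ c)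
    (hbc : b ≠ c) {B : Finset ℕ} (hB : B ⊆ H) (hw : 1 ≤ ∑ g ∈ B, u a g)
    (ha : HasPacking (u a) 2 (H \ B)) (hb : HasPacking (u b) 2 (H \ B))
    (hc : HasPacking (u c) 3 H) : CanAllocate u {a, b, c} H := by
  by_cases hcB : 1 ≤ ∑ g ∈ B, u c g
  · have : ({a, b, c} : Finset ι) = insert c {a, b} := by ext; simp; tauto
    rw [this]
    refine give (by simp [hac.symm, hbc.symm]) hB hcB (of_two hab ha (hu a) ?_)
    exact_mod_cast hb.le_sum (hu b)
  -- Here `c` values `H` at `3` or more and `B` below `1`, so the rest is worth at least `2` to her: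
  -- `b` cuts and `c` chooses.
  · refine give (by simp [hab, hac]) hB hw (of_two hbc hb (hu b) ?_)
    have h3 := hc.le_sum (hu c)
    have := Finset.sum_sdiff (f := u c) hB
    push_cast at h3
    linarith

/-- Three agents can be served if some pair, harmless for its owner, is not acceptable to both
other agents. -/
lemma of_pair {a b c : ι} (hu : ∀ i g, 0 ≤ u i g) (hab : a ≠ b) (hac : a ≠ c)
    (hbc : b ≠ c) {x y : ℕ} (hxy : x ≠ y) (hB : {x, y} ⊆ H) (hw : 1 ≤ u a x + u a y)
    (ha : HasPacking (u a) 2 (H \ {x, y})) (hb : HasPacking (u b) 3 H)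
    (hc : HasPacking (u c) 3 H) (hnot : ¬ (1 ≤ u b x + u b y ∧ 1 ≤ u c x + u c y)) :
    CanAllocate u {a, b, c} H := by
  have hw' : 1 ≤ ∑ g ∈ {x, y}, u a g := by rwa [Finset.sum_pair hxy]
  by_cases h : 1 ≤ u b x + u b y
  · have hc' := hc.sdiff_pair_of_lt hxy (not_le.1 fun h' => hnot ⟨h, h'⟩)
    have : ({a, b, c} : Finset ι) = {a, c, b} := by ext; simp; tauto
    rw [this]
    exact of_common_bundle hu hac hab hbc.symm hB hw' ha hc' hb
  · exact of_common_bundle hu hab hac hbc hB hw' ha (hb.sdiff_pair_of_lt hxy (not_le.1 h)) hc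

end CanAllocate

/-! ### Three agents, two of whom own pairs. -/

/-- A packing into `k` bundles one of which is the pair `{x, y}` with `x < y`. -/
def OwnsPair (u : ℕ → ℝ) (k : ℕ) (H : Finset ℕ) (x y : ℕ) : Prop :=
  x < y ∧ ∃ Q, IsPacking u k H Q ∧ {x, y} ∈ Q

namespace OwnsPair

variable {u : ℕ → ℝ} {k : ℕ} {H : Finset ℕ} {x y : ℕ}

lemma hasPacking (h : OwnsPair u k H x y) : HasPacking u k H := ⟨_, h.2.choose_spec.1⟩

lemma subset (h : OwnsPair u k H x y) : {x, y} ⊆ H := by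
  obtain ⟨-, Q, hQ, hm⟩ := h
  exact hQ.subset _ hm

lemma worth (h : OwnsPair u k H x y) : 1 ≤ u x + u y := by
  obtain ⟨hlt, Q, hQ, hm⟩ := h
  simpa [Finset.sum_pair hlt.ne] using hQ.worth _ hm

lemma sdiff (h : OwnsPair u (k + 1) H x y) : HasPacking u k (H \ {x, y}) := by
  obtain ⟨-, Q, hQ, hm⟩ := h
  exact ⟨_, hQ.erase hm⟩

lemma sdiff_of_le (hanti : Antitone u) (h : OwnsPair u (k + 1) H x y) {x' y' : ℕ}
    (hxy : x' < y') (hx : x ≤ x') (hy : y ≤ y') : HasPacking u k (H \ {x', y'}) := by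
  obtain ⟨hlt, Q, hQ, hm⟩ := h
  exact HasPacking.sdiff_pair_of_le hanti hQ hm (by simp) (by simp) hlt hxy hx hy

end OwnsPair

namespace CanAllocate

variable {ι : Type*} [DecidableEq ι] {u : ι → ℕ → ℝ} {H : Finset ℕ}

lemma of_two_hasPacking {a b : ι} (hu : ∀ i g, 0 ≤ u i g) (hab : a ≠ b)
    (ha : HasPacking (u a) 2 H) (hb : HasPacking (u b) 2 H) : CanAllocate u {a, b} H :=
  of_two hab ha (hu a) (by exact_mod_cast hb.le_sum (hu b))

/-- If all agents but the receiver of `B` keep a sufficiently large packing, three agents reduce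
to two. -/
lemma of_three_give {a b c : ι} (hu : ∀ i g, 0 ≤ u i g) (hab : a ≠ b) (hac : a ≠ c)
    (hbc : b ≠ c) {B : Finset ℕ} (hB : B ⊆ H) (hw : 1 ≤ ∑ g ∈ B, u a g)
    (hb : HasPacking (u b) 2 (H \ B)) (hc : HasPacking (u c) 2 (H \ B)) :
    CanAllocate u {a, b, c} H :=
  give (by simp [hab, hac]) hB hw (of_two_hasPacking hu hbc hb hc)

lemma of_single {a b c : ι} (hu : ∀ i g, 0 ≤ u i g) (hab : a ≠ b) (hac : a ≠ c)
    (hbc : b ≠ c) {g : ℕ} (hg : g ∈ H) (hw : 1 ≤ u a g)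
    (hb : HasPacking (u b) 3 H) (hc : HasPacking (u c) 3 H) :
    CanAllocate u {a, b, c} H :=
  of_three_give hu hab hac hbc (B := {g}) (by simpa using hg) (by simpa using hw)
    (hb.sdiff_singleton g) (hc.sdiff_singleton g)

/-- The main case of two agents owning pairs: the pair of `b` contains the best good. -/
lemma of_ownsPair_of_lt {a b c : ι} (hu : ∀ i g, 0 ≤ u i g) (hanti : ∀ i, Antitone (u i))
    (hab : a ≠ b) (hac : a ≠ c) (hbc : b ≠ c) {x y z w : ℕ} (ha : OwnsPair (u a) 3 H x y)
    (hb : OwnsPair (u b) 3 H z w) (hc : HasPacking (u c) 3 H) (hz : ∀ g ∈ H, z ≤ g)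
    (hzx : z < x) : CanAllocate u {a, b, c} H := by
  have perm1 : ({a, b, c} : Finset ι) = {b, a, c} := Finset.insert_comm _ _ _
  have perm2 : ({a, b, c} : Finset ι) = {b, c, a} := by ext; simp; tauto
  have hxy := ha.1
  have hzw := hb.1
  have hwa : 1 ≤ ∑ g ∈ {x, y}, u a g := by rw [Finset.sum_pair hxy.ne]; exact ha.worth
  have hwb : 1 ≤ ∑ g ∈ {z, w}, u b g := by rw [Finset.sum_pair hzw.ne]; exact hb.worth
  -- `{x, y}` is not dominated by `{z, w}`
  by_cases hyw : w ≤ y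
  · exact of_common_bundle hu hab hac hbc ha.subset hwa ha.sdiff
      (hb.sdiff_of_le (hanti b) hxy hzx.le hyw) hc
  push Not at hyw
  -- both pairs are acceptable to all
  by_cases hP : 1 ≤ u b x + u b y ∧ 1 ≤ u c x + u c y
  swap
  · exact of_pair hu hab hac hbc hxy.ne ha.subset ha.worth ha.sdiff hb.hasPacking hc hP
  by_cases hR : 1 ≤ u a z + u a w ∧ 1 ≤ u c z + u c w
  swap
  · rw [perm1]
    exact of_pair hu hab.symm hbc hac hzw.ne hb.subset hb.worth hb.sdiff ha.hasPacking hc hR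
  obtain ⟨Q, hQ, hcov⟩ := hc.exists_covering (hu c)
  obtain ⟨C, hC, hzC⟩ := hcov z (hb.subset (by simp))
  -- otherwise `C` dominates `{z, w}`
  by_cases hCw : ∃ d ∈ C, d ≠ z ∧ d ≤ w
  · obtain ⟨d, hd, hdz, hdw⟩ := hCw
    have hzd : z < d := lt_of_le_of_ne (hz d (hQ.subset C hC hd)) hdz.symm
    rw [perm2]
    exact of_common_bundle hu hbc hab.symm hac.symm hb.subset hwb hb.sdiff
      (HasPacking.sdiff_pair_of_le (hanti c) hQ hC hzC hd hzd hzw le_rfl hdw) ha.hasPacking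
  push Not at hCw
  -- Now `z < x < y < w`, while apart from `z` the bundle `C` has only goods after `w`.
  have hCxy : Disjoint ({x, y} : Finset ℕ) C := by
    rw [Finset.disjoint_left]
    intro g hg hgC
    simp only [Finset.mem_insert, Finset.mem_singleton] at hg
    have := hCw g hgC (by omega)
    omega
  -- some other bundle `Y` of `c` avoids `{z, w}`
  obtain ⟨Y, hY, hYC, hwY⟩ : ∃ Y ∈ Q, Y ≠ C ∧ w ∉ Y := by
    by_contra! hcon
    have h2 : 1 < (Q.erase C).card := by
      rw [Finset.card_erase_of_mem hC, hQ.card_eq]; norm_num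
    obtain ⟨D, hD, E, hE, hne⟩ := Finset.one_lt_card.1 h2
    rw [Finset.mem_erase] at hD hE
    exact hne (hQ.eq_of_mem hD.2 hE.2 (hcon D hD.2 hD.1) (hcon E hE.2 hE.1))
  have hzY : z ∉ Y := fun h => hYC (hQ.eq_of_mem hY hC h hzC)
  have hYzw : Disjoint ({z, w} : Finset ℕ) Y := by
    rw [Finset.disjoint_left]
    intro g hg hgY
    simp only [Finset.mem_insert, Finset.mem_singleton] at hg
    rcases hg with rfl | rfl
    exacts [hzY hgY, hwY hgY]
  -- an agent owning a pair accepts every bundle of `c` avoiding that pair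
  have key : ∀ {i j : ι} {p q : ℕ} {D : Finset ℕ}, i ≠ j → i ≠ c → j ≠ c →
      OwnsPair (u i) 3 H p q → 1 ≤ u j p + u j q → D ∈ Q → Disjoint {p, q} D →
      1 ≤ ∑ g ∈ D, u i g ∨ CanAllocate u {i, j, c} H := by
    intro i j p q D hij hic hjc hi hj hD hdis
    -- Without `{p, q}` the goods are worth at least `2` to `i`. If `i` rejects `D`, she is
    -- satisfied by what remains without `D` as well; then `j` takes the pair and `c` takes `D`.
    refine or_iff_not_imp_left.2 fun hlt => ?_
    have hDs : D ⊆ H \ {p, q} := Finset.subset_sdiff.2 ⟨hQ.subset D hD, hdis.symm⟩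
    have h2 := hi.sdiff.le_sum (hu i)
    have h3 := Finset.sum_sdiff (f := u i) hDs
    push_cast at h2
    exact of_three hij hic hjc (X := (H \ {p, q}) \ D) (Y := {p, q}) (Z := D)
      (Finset.sdiff_subset.trans Finset.sdiff_subset) hi.subset (hQ.subset D hD)
      (Finset.disjoint_of_subset_left Finset.sdiff_subset Finset.sdiff_disjoint)
      Finset.sdiff_disjoint hdis (by linarith)
      (by rw [Finset.sum_pair hi.1.ne]; exact hj) (hQ.worth D hD)
  rcases key hab hac hbc ha hP.1 hC hCxy with haC | h
  swap
  · exact h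
  rcases key hab.symm hbc hac hb hR.1 hY hYzw with hbY | h
  swap
  · rwa [perm1]
  obtain ⟨Z, hZ, hZC, hZY⟩ : ∃ Z ∈ Q, Z ≠ C ∧ Z ≠ Y := by
    have h1 : 0 < ((Q.erase C).erase Y).card := by
      rw [Finset.card_erase_of_mem (Finset.mem_erase.2 ⟨hYC, hY⟩),
        Finset.card_erase_of_mem hC, hQ.card_eq]
      norm_num
    obtain ⟨Z, hZ⟩ := Finset.card_pos.1 h1
    simp only [Finset.mem_erase] at hZ
    exact ⟨Z, hZ.2.2, hZ.2.1, hZ.1⟩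
  exact of_three hab hac hbc (hQ.subset C hC) (hQ.subset Y hY) (hQ.subset Z hZ)
    (hQ.disj C hC Y hY hYC.symm) (hQ.disj C hC Z hZ hZC.symm) (hQ.disj Y hY Z hZ hZY.symm)
    haC hbY (hQ.worth Z hZ)

/-- Three agents, two of whom own pairs, can be served. -/
lemma of_ownsPair {a b c : ι} (hu : ∀ i g, 0 ≤ u i g) (hanti : ∀ i, Antitone (u i))
    (hab : a ≠ b) (hac : a ≠ c) (hbc : b ≠ c) {x y z w : ℕ} (ha : OwnsPair (u a) 3 H x y)
    (hb : OwnsPair (u b) 3 H z w) (hc : HasPacking (u c) 3 H) : CanAllocate u {a, b, c} H := by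
  wlog hzx : z ≤ x generalizing a b x y z w
  · have perm1 : ({a, b, c} : Finset ι) = {b, a, c} := Finset.insert_comm _ _ _
    rw [perm1]
    exact this hab.symm hbc hac hb ha (by omega)
  have hxH : x ∈ H := ha.subset (by simp)
  have hyH : y ∈ H := ha.subset (by simp)
  rcases hzx.eq_or_lt with rfl | hzx
  · wlog hyw : w ≤ y generalizing a b y w
    · have perm1 : ({a, b, c} : Finset ι) = {b, a, c} := Finset.insert_comm _ _ _
      rw [perm1]
      exact this hab.symm hbc hac ha (hb.subset (by simp)) hb (by omega)
    refine of_common_bundle hu hab hac hbc ha.subset ?_ ha.sdiff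
      (hb.sdiff_of_le (hanti b) ha.1 le_rfl hyw) hc
    rw [Finset.sum_pair ha.1.ne]
    exact ha.worth
  · by_cases hlow : 2 ≤ (H.filter (· < x)).card
    · refine of_three_give hu hab hac hbc ha.subset ?_
        (hb.hasPacking.sdiff_low_pair (hu b) (hanti b) hxH hyH ha.1 hlow)
        (hc.sdiff_low_pair (hu c) (hanti c) hxH hyH ha.1 hlow)
      rw [Finset.sum_pair ha.1.ne]
      exact ha.worth
    -- At most one good precedes `x`; it must be `z`, which is therefore the best good.
    · refine of_ownsPair_of_lt hu hanti hab hac hbc ha hb hc (fun g hg => ?_) hzx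
      by_contra! hgz
      refine hlow (Finset.one_lt_card.2 ⟨g, ?_, z, ?_, hgz.ne⟩)
      · exact Finset.mem_filter.2 ⟨hg, by omega⟩
      · exact Finset.mem_filter.2 ⟨hb.subset (by simp), hzx⟩

end CanAllocate

/-! ### Counting pairs; three agents with at most eight goods. -/

namespace IsPacking

variable {u : ℕ → ℝ} {k : ℕ} {H : Finset ℕ} {Q : Finset (Finset ℕ)}

lemma two_le_card (h : IsPacking u k H Q) (hs : ∀ g ∈ H, u g < 1) {D : Finset ℕ}
    (hD : D ∈ Q) : 2 ≤ D.card := by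
  by_contra! hlt
  have h1 : 0 < D.card := Finset.card_pos.2 (h.nonempty hD)
  obtain ⟨g, rfl⟩ := Finset.card_eq_one.1 (show D.card = 1 by omega)
  have := h.worth _ hD
  rw [Finset.sum_singleton] at this
  exact absurd this (not_le.2 (hs g (h.subset _ hD (by simp))))

/-- No bundle is a singleton, so each has at least three goods unless it is a pair, which falls
short by one. -/
lemma three_mul_le (h : IsPacking u k H Q) (hs : ∀ g ∈ H, u g < 1) :
    3 * k ≤ H.card + (Q.filter fun D => D.card = 2).card := by
  have h1 : ∑ D ∈ Q, 3 ≤ ∑ D ∈ Q, (D.card + if D.card = 2 then 1 else 0) := by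
    refine Finset.sum_le_sum fun D hD => ?_
    have := h.two_le_card hs hD
    split_ifs <;> omega
  rw [Finset.sum_add_distrib, ← Finset.card_filter, Finset.sum_const, h.card_eq] at h1
  have := h.sum_card_le
  simp only [smul_eq_mul] at h1
  omega

lemma ownsPair (h : IsPacking u k H Q) {D : Finset ℕ} (hD : D ∈ Q) (hc : D.card = 2) :
    ∃ x y, D = {x, y} ∧ OwnsPair u k H x y := by
  obtain ⟨x, y, hne, rfl⟩ := Finset.card_eq_two.1 hc
  rcases hne.lt_or_gt with hlt | hlt
  · exact ⟨x, y, rfl, hlt, Q, h, hD⟩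
  · exact ⟨y, x, Finset.pair_comm _ _, hlt, Q, h, Finset.pair_comm x y ▸ hD⟩

end IsPacking

namespace CanAllocate

variable {ι : Type*} [DecidableEq ι] {u : ι → ℕ → ℝ} {H : Finset ℕ}

lemma of_three_of_card_le (hu : ∀ i g, 0 ≤ u i g) (hanti : ∀ i, Antitone (u i)) {N : Finset ι}
    (hN : N.card = 3) (hH : H.card ≤ 8) (h : ∀ i ∈ N, HasPacking (u i) 3 H) :
    CanAllocate u N H := by
  by_cases hs : ∃ i ∈ N, ∃ g ∈ H, 1 ≤ u i g
  · obtain ⟨i, hi, g, hg, hw⟩ := hs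
    have hcard : (N.erase i).card = 2 := by rw [Finset.card_erase_of_mem hi, hN]
    obtain ⟨b, c, hbc, hE⟩ := Finset.card_eq_two.1 hcard
    have hb : b ∈ N.erase i := by simp [hE]
    have hc : c ∈ N.erase i := by simp [hE]
    rw [Finset.mem_erase] at hb hc
    rw [← Finset.insert_erase hi, hE]
    exact of_single hu hb.1.symm hc.1.symm hbc hg hw (h b hb.2) (h c hc.2)
  · push Not at hs
    have hpair : ∀ i ∈ N, ∃ x y, OwnsPair (u i) 3 H x y := by
      intro i hi
      obtain ⟨Q, hQ⟩ := h i hi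
      have h3 := hQ.three_mul_le (hs i hi)
      obtain ⟨D, hD⟩ := Finset.card_pos.1
        (show 0 < (Q.filter fun D => D.card = 2).card by omega)
      rw [Finset.mem_filter] at hD
      obtain ⟨x, y, -, hxy⟩ := hQ.ownsPair hD.1 hD.2
      exact ⟨x, y, hxy⟩
    obtain ⟨a, b, c, hab, hac, hbc, rfl⟩ := Finset.card_eq_three.1 hN
    obtain ⟨x, y, ha⟩ := hpair a (by simp)
    obtain ⟨z, w, hb⟩ := hpair b (by simp)
    exact of_ownsPair hu hanti hab hac hbc ha hb (h c (by simp))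

end CanAllocate

/-! ### Comparable triples in partitions of nine goods. -/

lemma Finset.exists_eq_triple_of_isGreatest {D : Finset ℕ} (hD : D.card = 3) {z : ℕ} (hz : z ∈ D)
    (hmax : ∀ g ∈ D, g ≤ z) : ∃ f x, f < x ∧ x < z ∧ D = {f, x, z} := by
  obtain ⟨f, x, hfx, hE⟩ := Finset.card_eq_two.1
    (show (D.erase z).card = 2 by rw [Finset.card_erase_of_mem hz, hD])
  have hf : f ∈ D.erase z := by simp [hE]
  have hx : x ∈ D.erase z := by simp [hE]
  rw [Finset.mem_erase] at hf hx
  have hf' := lt_of_le_of_ne (hmax f hf.2) hf.1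
  have hx' := lt_of_le_of_ne (hmax x hx.2) hx.1
  rw [← Finset.insert_erase hz, hE]
  rcases hfx.lt_or_gt with h | h
  · exact ⟨f, x, h, hx', by ext; simp; tauto⟩
  · exact ⟨x, f, h, hf', by ext; simp; tauto⟩

lemma Finset.exists_eq_triple_of_isLeast {D : Finset ℕ} (hD : D.card = 3) {m : ℕ} (hm : m ∈ D)
    (hmin : ∀ g ∈ D, m ≤ g) : ∃ p q, m < p ∧ p < q ∧ D = {m, p, q} := by
  obtain ⟨f, x, hfx, hE⟩ := Finset.card_eq_two.1
    (show (D.erase m).card = 2 by rw [Finset.card_erase_of_mem hm, hD])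
  have hf : f ∈ D.erase m := by simp [hE]
  have hx : x ∈ D.erase m := by simp [hE]
  rw [Finset.mem_erase] at hf hx
  have hf' := lt_of_le_of_ne (hmin f hf.2) hf.1.symm
  have hx' := lt_of_le_of_ne (hmin x hx.2) hx.1.symm
  rw [← Finset.insert_erase hm, hE]
  rcases hfx.lt_or_gt with h | h
  · exact ⟨f, x, hf', h, rfl⟩
  · exact ⟨x, f, hx', h, by ext; simp; tauto⟩

/-- Some triple of `Q'` is goodwise at least as good as some triple of `Q`. -/
def DominatesTriple (Q Q' : Finset (Finset ℕ)) : Prop :=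
  ∃ b₁ b₂ b₃ c₁ c₂ c₃ : ℕ, b₁ < b₂ ∧ b₂ < b₃ ∧ c₁ < c₂ ∧ c₂ < c₃ ∧ c₁ ≤ b₁ ∧ c₂ ≤ b₂ ∧ c₃ ≤ b₃ ∧
    {b₁, b₂, b₃} ∈ Q ∧ {c₁, c₂, c₃} ∈ Q'

/-- `Q` is a partition of `H` into triples. -/
structure IsTriplePartition (H : Finset ℕ) (Q : Finset (Finset ℕ)) : Prop where
  card_eq : ∀ D ∈ Q, D.card = 3
  subset : ∀ D ∈ Q, D ⊆ H
  cover : ∀ g ∈ H, ∃ D ∈ Q, g ∈ D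
  eq_of_mem : ∀ D ∈ Q, ∀ E ∈ Q, ∀ g, g ∈ D → g ∈ E → D = E

/-- Compare the triples `{f i, x i, z}` containing the worst good. Incomparability forces `f a < f b
< f c < x c < x b < x a < z`, leaving at most two goods between `x a` and `z`. The triples of `b`
and `c` containing the best good `m` must both use exactly these two goods, so they coincide. -/
lemma exists_dominatesTriple_of_le {ι : Type*} {H : Finset ℕ} (hH : H.card = 9)
    {Q : ι → Finset (Finset ℕ)} {T : Finset ι} (hQ : ∀ i ∈ T, IsTriplePartition H (Q i))
    {m z : ℕ} (hm : m ∈ H) (hmin : ∀ g ∈ H, m ≤ g) (hz : z ∈ H) (hmax : ∀ g ∈ H, g ≤ z)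
    {f x : ι → ℕ} (hfx : ∀ i ∈ T, f i < x i ∧ x i < z ∧ {f i, x i, z} ∈ Q i)
    {a b c : ι} (ha : a ∈ T) (hb : b ∈ T) (hc : c ∈ T) (hab : a ≠ b) (hac : a ≠ c)
    (hbc : b ≠ c) (h₁ : f a ≤ f b) (h₂ : f b ≤ f c) :
    ∃ i ∈ T, ∃ j ∈ T, i ≠ j ∧ DominatesTriple (Q i) (Q j) := by
  by_contra! hcon
  have lt_of : ∀ i ∈ T, ∀ j ∈ T, i ≠ j → f i ≤ f j → f i < f j ∧ x j < x i := by
    intro i hi j hj hij hle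
    obtain ⟨hi1, hi2, hi3⟩ := hfx i hi
    obtain ⟨hj1, hj2, hj3⟩ := hfx j hj
    have hx : x j < x i := by
      by_contra! hx
      exact hcon j hj i hi hij.symm
        ⟨_, _, _, _, _, _, hj1, hj2, hi1, hi2, hle, hx, le_rfl, hj3, hi3⟩
    refine ⟨lt_of_le_of_ne hle fun heq => ?_, hx⟩
    exact hcon i hi j hj hij
      ⟨_, _, _, _, _, _, hi1, hi2, hj1, hj2, heq.ge, hx.le, le_rfl, hi3, hj3⟩
  obtain ⟨hfab, hxab⟩ := lt_of a ha b hb hab h₁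
  obtain ⟨hfbc, hxbc⟩ := lt_of b hb c hc hbc h₂
  have mem_of : ∀ i ∈ T, f i ∈ H ∧ x i ∈ H := fun i hi =>
    ⟨(hQ i hi).subset _ (hfx i hi).2.2 (by simp), (hQ i hi).subset _ (hfx i hi).2.2 (by simp)⟩
  set W := H.filter fun g => x a < g ∧ g < z with hW
  have hfxc := (hfx c hc).1
  have hxaz := (hfx a ha).2.1
  have hWcard : W.card ≤ 2 := by
    set S : Finset ℕ := {z, x a, x b, x c, f c, f b, f a} with hS
    have hScard : S.card = 7 := by
      rw [hS]
      repeat rw [Finset.card_insert_of_notMem]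
      · simp
      all_goals simp only [Finset.mem_insert, Finset.mem_singleton]; omega
    have hSH : S ⊆ H := by
      intro g hg
      simp only [hS, Finset.mem_insert, Finset.mem_singleton] at hg
      rcases hg with rfl | rfl | rfl | rfl | rfl | rfl | rfl
      exacts [hz, (mem_of a ha).2, (mem_of b hb).2, (mem_of c hc).2, (mem_of c hc).1,
        (mem_of b hb).1, (mem_of a ha).1]
    have hWS : W ⊆ H \ S := by
      intro g hg
      simp only [hW, Finset.mem_filter] at hg
      simp only [hS, Finset.mem_sdiff, Finset.mem_insert, Finset.mem_singleton]
      exact ⟨hg.1, by omega⟩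
    have := Finset.card_le_card hWS
    rw [Finset.card_sdiff_of_subset hSH, hH, hScard] at this
    exact this
  -- If `p ≤ x a`, then `{m, p, q}` would dominate `{f a, x a, z}`. Also `q ≠ z`, because `m` is not
  -- in the triple of `i` containing `z`.
  have least : ∀ i ∈ T, a ≠ i → f a < f i →
      ∃ p q, m < p ∧ p < q ∧ {m, p, q} ∈ Q i ∧ ({p, q} : Finset ℕ) = W := by
    intro i hi hai hfi
    obtain ⟨D, hD, hmD⟩ := (hQ i hi).cover m hm
    obtain ⟨p, q, hmp, hpq, rfl⟩ := Finset.exists_eq_triple_of_isLeast ((hQ i hi).card_eq D hD) hmD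
      fun g hg => hmin g ((hQ i hi).subset D hD hg)
    have hpH : p ∈ H := (hQ i hi).subset _ hD (by simp)
    have hqH : q ∈ H := (hQ i hi).subset _ hD (by simp)
    obtain ⟨ha1, ha2, ha3⟩ := hfx a ha
    obtain ⟨hi1, hi2, hi3⟩ := hfx i hi
    have hma := hmin _ (mem_of a ha).1
    have hp : x a < p := by
      by_contra! hp
      exact hcon a ha i hi hai
        ⟨_, _, _, _, _, _, ha1, ha2, hmp, hpq, hma, hp, hmax q hqH, ha3, hD⟩
    have hqz : q ≠ z := by
      rintro rfl
      have heq := (hQ i hi).eq_of_mem _ hD _ hi3 q (by simp) (by simp)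
      have : m ∈ ({f i, x i, q} : Finset ℕ) := heq ▸ hmD
      simp only [Finset.mem_insert, Finset.mem_singleton] at this
      omega
    have hq : q < z := lt_of_le_of_ne (hmax q hqH) hqz
    refine ⟨p, q, hmp, hpq, hD, Finset.eq_of_subset_of_card_le ?_ ?_⟩
    · intro g hg
      simp only [Finset.mem_insert, Finset.mem_singleton] at hg
      rw [hW, Finset.mem_filter]
      rcases hg with rfl | rfl
      · exact ⟨hpH, hp, by omega⟩
      · exact ⟨hqH, by omega, hq⟩
    · rwa [Finset.card_pair hpq.ne]
  obtain ⟨p, q, hmp, hpq, hD, hpW⟩ := least b hb hab hfab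
  obtain ⟨p', q', hmp', hpq', hD', hpW'⟩ := least c hc hac (hfab.trans hfbc)
  have heq : ({m, p', q'} : Finset ℕ) = {m, p, q} := by rw [hpW', hpW]
  exact hcon b hb c hc hbc
    ⟨_, _, _, _, _, _, hmp, hpq, hmp, hpq, le_rfl, le_rfl, le_rfl, hD, heq ▸ hD'⟩

/-- Among three partitions of nine goods into triples, two are comparable. -/
lemma exists_dominatesTriple {ι : Type*} {H : Finset ℕ} (hH : H.card = 9)
    {Q : ι → Finset (Finset ℕ)} {T : Finset ι} (hT : T.card = 3)
    (hQ : ∀ i ∈ T, IsTriplePartition H (Q i)) :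
    ∃ i ∈ T, ∃ j ∈ T, i ≠ j ∧ DominatesTriple (Q i) (Q j) := by
  classical
  have hne : H.Nonempty := Finset.card_pos.1 (by omega)
  have hmax : ∀ g ∈ H, g ≤ H.max' hne := fun g hg => H.le_max' g hg
  have hfx : ∀ i ∈ T, ∃ f x, f < x ∧ x < H.max' hne ∧ {f, x, H.max' hne} ∈ Q i := by
    intro i hi
    obtain ⟨D, hD, hzD⟩ := (hQ i hi).cover _ (H.max'_mem hne)
    obtain ⟨f, x, h1, h2, rfl⟩ := Finset.exists_eq_triple_of_isGreatest ((hQ i hi).card_eq D hD)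
      hzD fun g hg => hmax g ((hQ i hi).subset D hD hg)
    exact ⟨f, x, h1, h2, hD⟩
  choose! f x hfx using hfx
  obtain ⟨a, b, c, hab, hac, hbc, rfl⟩ := Finset.card_eq_three.1 hT
  have ha : a ∈ ({a, b, c} : Finset ι) := by simp
  have hb : b ∈ ({a, b, c} : Finset ι) := by simp
  have hc : c ∈ ({a, b, c} : Finset ι) := by simp
  have key := @exists_dominatesTriple_of_le ι H hH Q {a, b, c} hQ _ _ (H.min'_mem hne)
    (fun g hg => H.min'_le g hg) (H.max'_mem hne) hmax f x hfx
  rcases le_total (f a) (f b) with h1 | h1 <;> rcases le_total (f b) (f c) with h2 | h2 <;>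
    rcases le_total (f a) (f c) with h3 | h3
  · exact key ha hb hc hab hac hbc h1 h2
  · exact key ha hb hc hab hac hbc h1 h2
  · exact key ha hc hb hac hab hbc.symm h3 h2
  · exact key hc ha hb hac.symm hbc.symm hab h3 h1
  · exact key hb ha hc hab.symm hbc hac h1 h3
  · exact key hb hc ha hbc hab.symm hac.symm h2 h3
  · exact key hc hb ha hbc.symm hac.symm hab.symm h2 h1
  · exact key hc hb ha hbc.symm hac.symm hab.symm h2 h1

/-! ### Four agents and at most ten goods, one of which satisfies an agent. -/

/-- The bundle sacrificed for `g` can be chosen different from `P`, so an owned pair survives the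
removal of a good outside it. -/
lemma IsPacking.exists_sdiff_singleton {u : ℕ → ℝ} {k : ℕ} {H : Finset ℕ}
    {Q : Finset (Finset ℕ)} (h : IsPacking u (k + 1) H Q) (hk : 0 < k) {P : Finset ℕ}
    (hP : P ∈ Q) {g : ℕ} (hg : g ∉ P) : ∃ Q', IsPacking u k (H \ {g}) Q' ∧ P ∈ Q' := by
  by_cases hgQ : ∃ D ∈ Q, g ∈ D
  · obtain ⟨D, hD, hgD⟩ := hgQ
    exact ⟨_, (h.erase hD).mono (Finset.sdiff_subset_sdiff le_rfl (by simpa using hgD)),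
      Finset.mem_erase.2 ⟨fun heq => hg (heq ▸ hgD), hP⟩⟩
  · push Not at hgQ
    obtain ⟨D, hD, hDP⟩ : ∃ D ∈ Q, D ≠ P :=
      Finset.exists_mem_ne (by rw [h.card_eq]; omega) P
    have hE := h.erase hD
    refine ⟨Q.erase D, ⟨hE.card_eq, hE.disj, fun E hEQ => ?_, hE.worth⟩,
      Finset.mem_erase.2 ⟨hDP.symm, hP⟩⟩
    have hEQ' := Finset.mem_of_mem_erase hEQ
    rw [Finset.subset_sdiff, Finset.disjoint_singleton_right]
    exact ⟨h.subset E hEQ', hgQ E hEQ'⟩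

/-- Three disjoint bundles of at least three goods among at most nine force equality throughout. -/
lemma IsPacking.isTriplePartition {u : ℕ → ℝ} {H : Finset ℕ} {Q : Finset (Finset ℕ)}
    (h : IsPacking u 3 H Q) (hH : H.card ≤ 9) (h3 : ∀ D ∈ Q, 3 ≤ D.card) :
    H.card = 9 ∧ IsTriplePartition H Q := by
  have h9 : ∑ D ∈ Q, 3 = 9 := by rw [Finset.sum_const, h.card_eq]; rfl
  have hle := Finset.sum_le_sum h3
  have hsum := h.sum_card_le
  have heq : ∑ D ∈ Q, 3 = ∑ D ∈ Q, D.card := by omega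
  have hun : Q.biUnion id = H := by
    refine Finset.eq_of_subset_of_card_le (Finset.biUnion_subset.2 h.subset) ?_
    rw [Finset.card_biUnion (t := id) (fun D hD E hE => h.disj D hD E hE)]
    simp only [id]
    omega
  refine ⟨by omega, fun D hD => ((Finset.sum_eq_sum_iff_of_le h3).1 heq D hD).symm, h.subset,
    fun g hg => ?_, fun D hD E hE g => h.eq_of_mem hD hE⟩
  rw [← hun, Finset.mem_biUnion] at hg
  exact hg

lemma DominatesTriple.exists_sdiff {u u' : ℕ → ℝ} {H : Finset ℕ} {Q Q' : Finset (Finset ℕ)}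
    (hanti' : Antitone u') {k : ℕ} (hQ : IsPacking u (k + 1) H Q)
    (hQ' : IsPacking u' (k + 1) H Q') (h : DominatesTriple Q Q') :
    ∃ B ∈ Q, HasPacking u k (H \ B) ∧ HasPacking u' k (H \ B) := by
  obtain ⟨b₁, b₂, b₃, c₁, c₂, c₃, hb1, hb2, hc1, hc2, h1, h2, h3, hB, hC⟩ := h
  exact ⟨_, hB, ⟨_, hQ.erase hB⟩,
    HasPacking.sdiff_triple_of_le hanti' hQ' hC hc1 hc2 hb1 hb2 h1 h2 h3⟩

namespace CanAllocate

variable {ι : Type*} [DecidableEq ι] {u : ι → ℕ → ℝ} {H : Finset ℕ}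

lemma exists_erase_eq {N : Finset ι} (hN : N.card = 4) {s i j : ι} (hs : s ∈ N) (hi : i ∈ N)
    (hj : j ∈ N) (hsi : s ≠ i) (hsj : s ≠ j) (hij : i ≠ j) :
    ∃ c ∈ N, i ≠ c ∧ j ≠ c ∧ N.erase s = {i, j, c} := by
  have hi' : i ∈ N.erase s := Finset.mem_erase.2 ⟨hsi.symm, hi⟩
  have hj' : j ∈ (N.erase s).erase i := Finset.mem_erase.2
    ⟨hij.symm, Finset.mem_erase.2 ⟨hsj.symm, hj⟩⟩
  obtain ⟨c, hc⟩ := Finset.card_eq_one.1 (show (((N.erase s).erase i).erase j).card = 1 by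
    rw [Finset.card_erase_of_mem hj', Finset.card_erase_of_mem hi', Finset.card_erase_of_mem hs,
      hN])
  have hcm : c ∈ ((N.erase s).erase i).erase j := by simp [hc]
  simp only [Finset.mem_erase] at hcm
  refine ⟨c, hcm.2.2.2, hcm.2.1.symm, hcm.1.symm, ?_⟩
  rw [← Finset.insert_erase hi', ← Finset.insert_erase hj', hc]

/-- Four agents and at most ten goods, when the best good alone satisfies some agent. -/
lemma of_four_of_single (hu : ∀ i g, 0 ≤ u i g) (hanti : ∀ i, Antitone (u i)) {N : Finset ι}
    (hN : N.card = 4) (hH : H.card ≤ 10) (h : ∀ i ∈ N, HasPacking (u i) 4 H) {m : ℕ}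
    (hm : m ∈ H) (hmin : ∀ g ∈ H, m ≤ g) {s₀ : ι} (hs₀ : s₀ ∈ N) (hw₀ : 1 ≤ u s₀ m) :
    CanAllocate u N H := by
  classical
  set H₀ := H \ {m} with hH₀
  have hH₀card : H₀.card ≤ 9 := by
    rw [hH₀, Finset.card_sdiff_of_subset (by simpa using hm), Finset.card_singleton]
    omega
  have h₀ : ∀ i ∈ N, HasPacking (u i) 3 H₀ := fun i hi => (h i hi).sdiff_singleton m
  set S := N.filter fun i => 1 ≤ u i m with hS
  have reduce : ∀ s ∈ S, CanAllocate u (N.erase s) H₀ → CanAllocate u N H := by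
    intro s hs hcan
    rw [hS, Finset.mem_filter] at hs
    exact give_erase hs.1 (B := {m}) (by simpa using hm) (by simpa using hs.2) hcan
  have hSN : S ⊆ N := Finset.filter_subset _ _
  -- Four bundles without singletons on at most ten goods include two pairs, and at most one of them
  -- contains `m`.
  have owner : ∀ i ∈ N, i ∉ S → ∃ x y, OwnsPair (u i) 3 H₀ x y := by
    intro i hi hiS
    have hlt : u i m < 1 := by
      rw [hS, Finset.mem_filter] at hiS
      exact not_le.1 fun hle => hiS ⟨hi, hle⟩
    obtain ⟨Q, hQ⟩ := h i hi
    have h3 := hQ.three_mul_le fun g hg => (hanti i (hmin g hg)).trans_lt hlt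
    obtain ⟨D, hD, E, hE, hne⟩ := Finset.one_lt_card.1
      (show 1 < (Q.filter fun D => D.card = 2).card by omega)
    rw [Finset.mem_filter] at hD hE
    obtain ⟨P, hP, hPc, hmP⟩ : ∃ P ∈ Q, P.card = 2 ∧ m ∉ P := by
      by_cases hmD : m ∈ D
      · exact ⟨E, hE.1, hE.2, fun hmE => hne (hQ.eq_of_mem hD.1 hE.1 hmD hmE)⟩
      · exact ⟨D, hD.1, hD.2, hmD⟩
    obtain ⟨Q', hQ', hPQ'⟩ := hQ.exists_sdiff_singleton (by norm_num) hP hmP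
    obtain ⟨x, y, -, hxy⟩ := hQ'.ownsPair hPQ' hPc
    exact ⟨x, y, hxy⟩
  have two_owners : ∀ i ∈ N, ∀ j ∈ N, ∀ s ∈ S, i ≠ j → s ≠ i → s ≠ j →
      (∃ x y, OwnsPair (u i) 3 H₀ x y) → (∃ x y, OwnsPair (u j) 3 H₀ x y) →
      CanAllocate u N H := by
    rintro i hi j hj s hs hij hsi hsj ⟨x, y, hxy⟩ ⟨z, w, hzw⟩
    obtain ⟨c, hc, hic, hjc, hE⟩ := exists_erase_eq hN (hSN hs) hi hj hsi hsj hij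
    refine reduce s hs ?_
    rw [hE]
    exact of_ownsPair hu hanti hij hic hjc hxy hzw (h₀ c hc)
  have hs₀S : s₀ ∈ S := Finset.mem_filter.2 ⟨hs₀, hw₀⟩
  by_cases hSc : S.card ≤ 2
  · obtain ⟨i, hi, j, hj, hij⟩ := Finset.one_lt_card.1 (show 1 < (N \ S).card by
      rw [Finset.card_sdiff_of_subset hSN]; omega)
    rw [Finset.mem_sdiff] at hi hj
    exact two_owners i hi.1 j hj.1 s₀ hs₀S hij (fun h => hi.2 (h ▸ hs₀S))
      (fun h => hj.2 (h ▸ hs₀S)) (owner i hi.1 hi.2) (owner j hj.1 hj.2)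
  set O := N.filter fun i => ∃ x y, OwnsPair (u i) 3 H₀ x y with hO
  by_cases hOc : 1 < O.card
  · obtain ⟨i, hi, j, hj, hij⟩ := Finset.one_lt_card.1 hOc
    rw [hO, Finset.mem_filter] at hi hj
    -- Since `S` has at least three members, one of them is neither `i` nor `j` and can take `m`.
    obtain ⟨s, hs, hsi⟩ := Finset.exists_mem_ne
      (show 1 < (S.erase j).card by have := Finset.pred_card_le_card_erase (s := S) (a := j); omega) i
    rw [Finset.mem_erase] at hs
    exact two_owners i hi.1 j hj.1 s hs.2 hij hsi hs.1 hi.2 hj.2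
  -- At least three agents own no pair after `m` is removed; by `owner` all of them accept `m`, so
  -- any one can take it.
  have hT₀c : 3 ≤ (N \ O).card := by
    rw [Finset.card_sdiff_of_subset (show O ⊆ N from Finset.filter_subset _ _)]; omega
  obtain ⟨T, hTO, hTc⟩ := Finset.exists_subset_card_eq hT₀c
  have hTN : T ⊆ N := hTO.trans Finset.sdiff_subset
  have hTS : ∀ i ∈ T, i ∈ S := by
    intro i hi
    by_contra hiS
    exact (Finset.mem_sdiff.1 (hTO hi)).2
      (Finset.mem_filter.2 ⟨hTN hi, owner i (hTN hi) hiS⟩)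
  have hTno : ∀ i ∈ T, ∀ x y, ¬ OwnsPair (u i) 3 H₀ x y := by
    intro i hi x y hxy
    exact (Finset.mem_sdiff.1 (hTO hi)).2 (Finset.mem_filter.2 ⟨hTN hi, x, y, hxy⟩)
  by_cases hsing : ∃ i ∈ T, ∃ g ∈ H₀, 1 ≤ u i g
  · obtain ⟨i, hi, g, hg, hw⟩ := hsing
    obtain ⟨s, hs, hsi⟩ := Finset.exists_mem_ne (show 1 < T.card by omega) i
    obtain ⟨j, hj, hjn⟩ := Finset.exists_mem_ne (show 1 < (T.erase i).card by
      rw [Finset.card_erase_of_mem hi]; omega) s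
    rw [Finset.mem_erase] at hj
    obtain ⟨c, hc, hic, hjc, hE⟩ :=
      exists_erase_eq hN (hTN hs) (hTN hi) (hTN hj.2) hsi hjn.symm hj.1.symm
    refine reduce s (hTS s hs) ?_
    rw [hE]
    exact of_single hu hj.1.symm hic hjc hg hw (h₀ j (hTN hj.2)) (h₀ c hc)
  push Not at hsing
  have hpart : ∀ i ∈ T, ∃ Q, IsPacking (u i) 3 H₀ Q ∧ H₀.card = 9 ∧ IsTriplePartition H₀ Q := by
    intro i hi
    obtain ⟨Q, hQ⟩ := h₀ i (hTN hi)
    refine ⟨Q, hQ, hQ.isTriplePartition hH₀card fun D hD => ?_⟩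
    have h2 := hQ.two_le_card (hsing i hi) hD
    by_contra! hlt
    obtain ⟨x, y, -, hxy⟩ := hQ.ownsPair hD (by omega)
    exact hTno i hi x y hxy
  choose! Q hQ hcard hQT using hpart
  obtain ⟨t, ht⟩ : T.Nonempty := Finset.card_pos.1 (by omega)
  obtain ⟨i, hi, j, hj, hij, hdom⟩ := exists_dominatesTriple (hcard t ht) hTc hQT
  obtain ⟨B, hB, hBi, hBj⟩ := hdom.exists_sdiff (hanti j) (hQ i hi) (hQ j hj)
  -- The third member of `T` takes `m`; the dominated triple `B` is then harmless to both `i` and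
  -- `j`.
  obtain ⟨s, hs, hsi⟩ := Finset.exists_mem_ne (show 1 < (T.erase j).card by
    rw [Finset.card_erase_of_mem hj]; omega) i
  rw [Finset.mem_erase] at hs
  obtain ⟨c, hc, hic, hjc, hE⟩ := exists_erase_eq hN (hTN hs.2) (hTN hi) (hTN hj) hsi hs.1 hij
  refine reduce s (hTS s hs.2) ?_
  rw [hE]
  exact of_common_bundle hu hij hic hjc ((hQ i hi).subset B hB) ((hQ i hi).worth B hB) hBi hBj
    (h₀ c hc)

end CanAllocate

/-! ### The induction for four or more agents. -/

lemma Finset.card_filter_rank_lt_le (H : Finset ℕ) (k : ℕ) :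
    (H.filter fun g => (H.filter (· < g)).card < k).card ≤ k := by
  set L := H.filter fun g => (H.filter (· < g)).card < k with hL
  rcases L.eq_empty_or_nonempty with h | h
  · simp [h]
  · have hg := L.max'_mem h
    have hsub : L ⊆ insert (L.max' h) (H.filter (· < L.max' h)) := by
      intro x hx
      rcases (L.le_max' x hx).eq_or_lt with heq | hlt
      · exact Finset.mem_insert.2 (Or.inl heq)
      · exact Finset.mem_insert_of_mem
          (Finset.mem_filter.2 ⟨(Finset.mem_filter.1 hx).1, hlt⟩)
    have h1 := Finset.card_le_card hsub
    have h2 := Finset.card_insert_le (L.max' h) (H.filter (· < L.max' h))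
    have h3 := (Finset.mem_filter.1 hg).2
    omega

/-- In a bipartite relation in which every element of `N` is related to at least `r` elements of
`L`, some element of `L` is unrelated to at most one element of `N`. -/
lemma Finset.exists_card_filter_not_le_one {ι : Type*} {N : Finset ι} {L : Finset ℕ} {n : ℕ}
    (hn : 4 ≤ n) (hN : N.card = n) (hL : L.card < n) (R : ι → ℕ → Prop)
    [∀ i f, Decidable (R i f)] (hR : ∀ i ∈ N, 2 * n ≤ (L.filter (R i)).card + 6) :
    ∃ f ∈ L, (N.filter fun i => ¬ R i f).card ≤ 1 := by
  -- Counting unrelated pairs in two ways gives `2|L| ≤ n(|L| + 6 - 2n)`. As `2n - 6 ≤ |L| ≤ n - 1`,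
  -- only `n = 4` and `n = 5` remain, and there the inequality fails.
  by_contra! hcon
  have h1 : L.card * 2 ≤ ∑ f ∈ L, (N.filter fun i => ¬ R i f).card := by
    rw [← smul_eq_mul, ← Finset.sum_const]
    exact Finset.sum_le_sum hcon
  have h2 : ∑ f ∈ L, (N.filter fun i => ¬ R i f).card = ∑ i ∈ N, (L.filter fun f => ¬ R i f).card :=
    (Finset.sum_card_bipartiteAbove_eq_sum_card_bipartiteBelow (fun i f => ¬ R i f)).symm
  have h3 : ∀ i ∈ N, (L.filter fun f => ¬ R i f).card ≤ L.card + 6 - 2 * n := by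
    intro i hi
    have := Finset.card_filter_add_card_filter_not (s := L) (R i)
    have := hR i hi
    omega
  have h4 := Finset.sum_le_card_nsmul _ _ _ h3
  obtain ⟨i, hi⟩ : N.Nonempty := Finset.card_pos.1 (by omega)
  have h5 := (hR i hi).trans (Nat.add_le_add_right (Finset.card_filter_le _ _) 6)
  have hn5 : n ≤ 5 := by omega
  rw [hN, smul_eq_mul] at h4
  interval_cases n <;> omega

namespace CanAllocate

variable {ι : Type*} [DecidableEq ι] {u : ι → ℕ → ℝ} {H : Finset ℕ}

/-- If no single good satisfies any agent, the problem reduces to one agent and two goods fewer. -/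
lemma of_forall_lt_one (hu : ∀ i g, 0 ≤ u i g) (hanti : ∀ i, Antitone (u i)) {N : Finset ι}
    {k : ℕ} (hk : 3 ≤ k) (hN : N.card = k + 1) (hH : H.card ≤ k + 7)
    (h : ∀ i ∈ N, HasPacking (u i) (k + 1) H) (hs : ∀ i ∈ N, ∀ g ∈ H, u i g < 1)
    (hrec : ∀ i ∈ N, ∀ H' ⊆ H, H'.card + 2 = H.card →
      (∀ j ∈ N.erase i, HasPacking (u j) k H') → CanAllocate u (N.erase i) H') :
    CanAllocate u N H := by
  classical
  have reduce : ∀ i ∈ N, ∀ x ∈ H, ∀ y ∈ H, x < y → 1 ≤ u i x + u i y →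
      (∀ j ∈ N.erase i, HasPacking (u j) k (H \ {x, y})) → CanAllocate u N H := by
    intro i hi x hx y hy hxy hw hpack
    have hsub : ({x, y} : Finset ℕ) ⊆ H := by
      intro g hg
      simp only [Finset.mem_insert, Finset.mem_singleton] at hg
      rcases hg with rfl | rfl
      exacts [hx, hy]
    have hc := Finset.card_le_card hsub
    refine give_erase hi hsub (by rwa [Finset.sum_pair hxy.ne])
      (hrec i hi _ Finset.sdiff_subset ?_ hpack)
    rw [Finset.card_sdiff_of_subset hsub]
    rw [Finset.card_pair hxy.ne] at hc ⊢
    omega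
  by_cases hlow : ∃ i ∈ N, ∃ x y, OwnsPair (u i) (k + 1) H x y ∧ k ≤ (H.filter (· < x)).card
  · obtain ⟨i, hi, x, y, hxy, hc⟩ := hlow
    have hx : x ∈ H := hxy.subset (by simp)
    have hy : y ∈ H := hxy.subset (by simp)
    exact reduce i hi x hx y hy hxy.1 hxy.worth fun j hj =>
      (h j (Finset.mem_of_mem_erase hj)).sdiff_low_pair (hu j) (hanti j) hx hy hxy.1 hc
  push Not at hlow
  -- Every owned pair now has its better good among the top `k`. The pairs in one packing are
  -- disjoint, so their better goods are distinct elements of `L`.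
  set L := H.filter fun g => (H.filter (· < g)).card < k with hL
  set R : ι → ℕ → Prop := fun i f => ∃ t, OwnsPair (u i) (k + 1) H f t with hRdef
  have hR : ∀ i ∈ N, 2 * (k + 1) ≤ (L.filter (R i)).card + 6 := by
    intro i hi
    obtain ⟨Q, hQ⟩ := h i hi
    have h3 := hQ.three_mul_le (hs i hi)
    have hex : ∀ D ∈ Q.filter (fun D => D.card = 2), ∃ f ∈ L.filter (R i), f ∈ D := by
      intro D hD
      rw [Finset.mem_filter] at hD
      obtain ⟨x, y, rfl, hxy⟩ := hQ.ownsPair hD.1 hD.2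
      exact ⟨x, Finset.mem_filter.2 ⟨Finset.mem_filter.2 ⟨hxy.subset (by simp),
        hlow i hi x y hxy⟩, y, hxy⟩, by simp⟩
    choose! f hfL hfD using hex
    have := Finset.card_le_card_of_injOn f hfL fun D hD E hE hDE =>
      hQ.eq_of_mem (Finset.mem_filter.1 hD).1 (Finset.mem_filter.1 hE).1 (hfD D hD)
        (hDE ▸ hfD E hE)
    omega
  obtain ⟨f, hf, hfc⟩ := Finset.exists_card_filter_not_le_one (by omega) hN
    (Nat.lt_succ_of_le (H.card_filter_rank_lt_le k)) R hR
  set G := N.filter fun i => R i f with hG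
  have hGne : G.Nonempty := by
    have := Finset.card_filter_add_card_filter_not (s := N) fun i => R i f
    exact Finset.card_pos.1 (show 0 < (N.filter fun i => R i f).card by omega)
  choose! t ht using fun i (hi : i ∈ G) => (Finset.mem_filter.1 hi).2
  -- With the worst partner of `f`, the pair is dominated by the pair of every agent in `G`. At most
  -- one agent lies outside `G`: either she accepts this pair and takes it, or she rejects it and it
  -- is harmless to her.
  obtain ⟨i₀, hi₀, hmax⟩ := Finset.exists_max_image G t hGne
  have hi₀N := (Finset.mem_filter.1 hi₀).1
  have hlt := (ht i₀ hi₀).1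
  have hfH : f ∈ H := (ht i₀ hi₀).subset (by simp)
  have htH : t i₀ ∈ H := (ht i₀ hi₀).subset (by simp)
  have hGp : ∀ j ∈ N, R j f → HasPacking (u j) k (H \ {f, t i₀}) := by
    intro j hj hRj
    have hjG : j ∈ G := Finset.mem_filter.2 ⟨hj, hRj⟩
    exact (ht j hjG).sdiff_of_le (hanti j) hlt le_rfl (hmax j hjG)
  by_cases hacc : ∃ i ∈ N, ¬ R i f ∧ 1 ≤ u i f + u i (t i₀)
  · obtain ⟨i, hi, hRi, hw⟩ := hacc
    refine reduce i hi f hfH _ htH hlt hw fun j hj => ?_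
    rw [Finset.mem_erase] at hj
    refine hGp j hj.2 (by_contra fun hRj => hj.1 ?_)
    exact Finset.card_le_one.1 hfc j (Finset.mem_filter.2 ⟨hj.2, hRj⟩) i
      (Finset.mem_filter.2 ⟨hi, hRi⟩)
  · push Not at hacc
    refine reduce i₀ hi₀N f hfH _ htH hlt (ht i₀ hi₀).worth fun j hj => ?_
    have hjN := Finset.mem_of_mem_erase hj
    by_cases hRj : R j f
    · exact hGp j hjN hRj
    · exact (h j hjN).sdiff_pair_of_lt hlt.ne (hacc j hjN hRj)

/-- `n ≥ 4` agents with common preference order can be served from at most `n + 6` goods. -/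
theorem of_card_le (hu : ∀ i g, 0 ≤ u i g) (hanti : ∀ i, Antitone (u i)) (k : ℕ) (hk : 3 ≤ k) :
    ∀ (N : Finset ι) (H : Finset ℕ), N.card = k + 1 → H.card ≤ k + 7 →
      (∀ i ∈ N, HasPacking (u i) (k + 1) H) → CanAllocate u N H := by
  induction k, hk using Nat.le_induction with
  | base =>
    intro N H hN hH h
    by_cases hs : ∃ i ∈ N, ∃ g ∈ H, 1 ≤ u i g
    · obtain ⟨i, hi, g, hg, hw⟩ := hs
      -- A good satisfying `i` may be replaced by the best good.
      have hmin : ∀ x ∈ H, H.min' ⟨g, hg⟩ ≤ x := fun x hx => H.min'_le x hx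
      exact of_four_of_single hu hanti hN hH h (H.min'_mem ⟨g, hg⟩) hmin hi
        (hw.trans (hanti i (hmin g hg)))
    · push Not at hs
      refine of_forall_lt_one hu hanti le_rfl hN hH h hs fun i hi H' _ hc hp => ?_
      exact of_three_of_card_le hu hanti (by rw [Finset.card_erase_of_mem hi, hN]) (by omega) hp
  | succ k hk ih =>
    intro N H hN hH h
    by_cases hs : ∃ i ∈ N, ∃ g ∈ H, 1 ≤ u i g
    · obtain ⟨i, hi, g, hg, hw⟩ := hs
      have hgH : ({g} : Finset ℕ) ⊆ H := by simpa using hg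
      refine give_erase hi hgH (by simpa using hw) (ih _ _ ?_ ?_ fun j hj =>
        (h j (Finset.mem_of_mem_erase hj)).sdiff_singleton g)
      · rw [Finset.card_erase_of_mem hi, hN]; rfl
      · rw [Finset.card_sdiff_of_subset hgH, Finset.card_singleton]; omega
    · push Not at hs
      refine of_forall_lt_one hu hanti (by omega) hN hH h hs fun i hi H' _ hc hp => ?_
      exact ih _ _ (by rw [Finset.card_erase_of_mem hi, hN]; rfl) (by omega) hp

/-- Agents with a common preference order, `n ≠ 3` in number, can be served from at most `n + 6`
goods. -/
theorem of_card_ne_three (hu : ∀ i g, 0 ≤ u i g) (hanti : ∀ i, Antitone (u i)) {N : Finset ι}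
    (hN3 : N.card ≠ 3) (hH : H.card ≤ N.card + 6) (h : ∀ i ∈ N, HasPacking (u i) N.card H) :
    CanAllocate u N H := by
  rcases Nat.lt_or_ge N.card 4 with hlt | hge
  · have hcases : N.card = 0 ∨ N.card = 1 ∨ N.card = 2 := by omega
    rcases hcases with hc | hc | hc
    · rw [Finset.card_eq_zero.1 hc]
      exact empty
    · rw [hc] at h
      obtain ⟨i, rfl⟩ := Finset.card_eq_one.1 hc
      rw [← insert_empty_eq i]
      have := (h i (by simp)).le_sum (hu i)
      exact give (by simp) (Finset.Subset.refl H) (by exact_mod_cast this) empty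
    · rw [hc] at h
      obtain ⟨i, j, hij, rfl⟩ := Finset.card_eq_two.1 hc
      exact of_two_hasPacking hu hij (h i (by simp)) (h j (by simp))
  · obtain ⟨k, hk⟩ : ∃ k, N.card = k + 1 := ⟨N.card - 1, by omega⟩
    rw [hk] at h
    exact of_card_le hu hanti k (by omega) N H hk (by omega) h

end CanAllocate

/-! ### Reduction to a common preference order. -/

namespace FairInstance

variable {n m : ℕ} (I : FairInstance n m)

lemma val_empty (i : Fin n) : I.val i ∅ = 0 := by
  rw [I.additive, Finset.sum_empty]

lemma val_nonneg (hI : I.IsGoods) (i : Fin n) (S : Finset (Fin m)) : 0 ≤ I.val i S := by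
  rw [I.additive]
  exact Finset.sum_nonneg fun g _ => hI i g

/-- The maximin share is attained by some allocation. -/
lemma exists_isAllocation_mms_le (hn : 0 < n) (i : Fin n) :
    ∃ A : Fin n → Finset (Fin m), IsAllocation A ∧ ∀ j, I.mms i ≤ I.val i (A j) := by
  have hne : Nonempty {A : Fin n → Finset (Fin m) // IsAllocation A} := by
    refine ⟨fun j => if j = ⟨0, hn⟩ then Finset.univ else ∅, fun j l hjl => ?_,
      fun g => ⟨⟨0, hn⟩, by simp⟩⟩
    by_cases hj : j = ⟨0, hn⟩
    · have hl : l ≠ ⟨0, hn⟩ := fun h => hjl (hj.trans h.symm)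
      simp [hl]
    · simp [hj]
  obtain ⟨A, hA⟩ := exists_eq_ciSup_of_finite
    (f := fun A : {A : Fin n → Finset (Fin m) // IsAllocation A} => ⨅ j, I.val i (A.1 j))
  refine ⟨A.1, A.2, fun j => ?_⟩
  rw [mms, ← hA]
  exact ciInf_le (Set.finite_range _).bddBelow j

lemma mms_nonpos_of_lt (hn : 0 < n) (hmn : m < n) (i : Fin n) : I.mms i ≤ 0 := by
  obtain ⟨A, hA, hle⟩ := I.exists_isAllocation_mms_le hn i
  obtain ⟨j, hj⟩ : ∃ j, A j = ∅ := by
    by_contra! hcon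
    have hne : ∀ j, ∃ g, g ∈ A j := fun j => hcon j
    choose f hf using hne
    have hinj : Function.Injective f := by
      intro j l hjl
      by_contra hne
      exact Finset.disjoint_left.1 (hA.disjoint j l hne) (hf j) (hjl ▸ hf l)
    have := Fintype.card_le_of_injective f hinj
    simp only [Fintype.card_fin] at this
    omega
  have := hle j
  rwa [hj, I.val_empty] at this

/-- The goods in an order of weakly decreasing value for agent `i`. -/
noncomputable def order (i : Fin n) : Equiv.Perm (Fin m) := Tuple.sort fun g => -I.val i {g}

lemma val_order_le (i : Fin n) {a b : Fin m} (hab : a ≤ b) :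
    I.val i {I.order i b} ≤ I.val i {I.order i a} := by
  have := Tuple.monotone_sort (fun g => -I.val i {g}) hab
  simpa [order] using this

/-- A picking sequence: if the `k`-th turn belongs to `owner k`, the goods can be distributed so
that on every turn the owner receives a good worth at least her `k`-th best good. -/
lemma exists_picking (owner : Fin m → Fin n) : ∃ σ : Fin m → Fin m, Function.Bijective σ ∧
    ∀ k, I.val (owner k) {I.order (owner k) k} ≤ I.val (owner k) {σ k} := by
  -- Hall's condition: if `k` is the last turn in `K`, the owner of `k` alone allows `k + 1` goods
  -- (turns count from `0`), and `K` has at most that many turns.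
  obtain ⟨σ, hinj, hσ⟩ := (Finset.all_card_le_biUnion_card_iff_exists_injective
    fun k : Fin m => (Finset.Iic k).map (I.order (owner k)).toEmbedding).1 (by
      intro K
      rcases K.eq_empty_or_nonempty with rfl | hK
      · simp
      · have h1 : K ⊆ Finset.Iic (K.max' hK) := fun x hx => Finset.mem_Iic.2 (K.le_max' x hx)
        have h2 := Finset.subset_biUnion_of_mem
          (fun k : Fin m => (Finset.Iic k).map (I.order (owner k)).toEmbedding) (K.max'_mem hK)
        have h3 := Finset.card_le_card h2
        rw [Finset.card_map] at h3
        exact (Finset.card_le_card h1).trans h3)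
  refine ⟨σ, Finite.injective_iff_bijective.1 hinj, fun k => ?_⟩
  obtain ⟨r, hr, hrk⟩ := Finset.mem_map.1 (hσ k)
  rw [← hrk]
  exact I.val_order_le (owner k) (Finset.mem_Iic.1 hr)

/-- The values of agent `i` in decreasing order, scaled so that the maximin share becomes `1`;
agents with maximin share `0` are replaced by agents who value all goods equally. -/
noncomputable def scaled (i : Fin n) (k : ℕ) : ℝ :=
  if h : k < m then if 0 < I.mms i then I.val i {I.order i ⟨k, h⟩} / I.mms i else 1 else 0

lemma scaled_nonneg (hI : I.IsGoods) (i : Fin n) (k : ℕ) : 0 ≤ I.scaled i k := by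
  unfold scaled
  split_ifs with h hpos
  · exact div_nonneg (hI i _) hpos.le
  · exact zero_le_one
  · exact le_rfl

lemma scaled_antitone (hI : I.IsGoods) (i : Fin n) : Antitone (I.scaled i) := by
  intro a b hab
  by_cases hb : b < m
  · have ha : a < m := hab.trans_lt hb
    simp only [scaled, ha, hb, dif_pos]
    split_ifs with hpos
    · exact div_le_div_of_nonneg_right (I.val_order_le i hab) hpos.le
    · exact le_rfl
  · have : I.scaled i b = 0 := by simp [scaled, hb]
    rw [this]
    exact I.scaled_nonneg hI i a

lemma scaled_of_pos {i : Fin n} (hpos : 0 < I.mms i) (k : Fin m) :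
    I.scaled i k = I.val i {I.order i k} / I.mms i := by
  simp [scaled, hpos]

lemma hasPacking_scaled (hn : 0 < n) (hnm : n ≤ m) (i : Fin n) :
    HasPacking (I.scaled i) n (Finset.range m) := by
  obtain ⟨P, hdis, hsub, hw⟩ : ∃ P : Fin n → Finset ℕ, (∀ j l, j ≠ l → Disjoint (P j) (P l)) ∧
      (∀ j, P j ⊆ Finset.range m) ∧ ∀ j, 1 ≤ ∑ k ∈ P j, I.scaled i k := by
    by_cases hpos : 0 < I.mms i
    · obtain ⟨A, hA, hle⟩ := I.exists_isAllocation_mms_le hn i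
      refine ⟨fun j => (A j).map ((I.order i).symm.toEmbedding.trans Fin.valEmbedding),
        fun j l hjl => ?_, fun j => ?_, fun j => ?_⟩
      · rw [Finset.disjoint_map]
        exact hA.disjoint j l hjl
      · intro k hk
        obtain ⟨g, -, rfl⟩ := Finset.mem_map.1 hk
        simp
      · rw [Finset.sum_map]
        have h1 : ∀ g ∈ A j, I.scaled i (((I.order i).symm.toEmbedding.trans Fin.valEmbedding) g)
            = I.val i {g} / I.mms i := by
          intro g _
          simpa using I.scaled_of_pos hpos ((I.order i).symm g)
        rw [Finset.sum_congr rfl h1, ← Finset.sum_div, ← I.additive, le_div_iff₀ hpos, one_mul]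
        exact hle j
    -- Agents without a positive share value each good at `1`, so singletons pack; this needs `n ≤
    -- m`.
    · refine ⟨fun j => {j.1}, fun j l hjl => ?_, fun j => ?_, fun j => ?_⟩
      · simpa [Fin.ext_iff] using hjl
      · simpa using j.2.trans_le hnm
      · rw [Finset.sum_singleton, scaled, dif_pos (j.2.trans_le hnm), if_neg hpos]
  have hinj : Function.Injective P := by
    intro j l hjl
    by_contra hne
    have h0 : P j = ∅ := by
      have := hdis j l hne
      rwa [← hjl, disjoint_self] at this
    have := hw j
    rw [h0, Finset.sum_empty] at this
    linarith
  refine ⟨Finset.univ.image P, ?_, ?_, ?_, ?_⟩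
  · rw [Finset.card_image_of_injective _ hinj, Finset.card_univ, Fintype.card_fin]
  · simp only [Finset.mem_image]
    rintro _ ⟨j, -, rfl⟩ _ ⟨l, -, rfl⟩ hne
    exact hdis j l fun h => hne (by rw [h])
  · simp only [Finset.mem_image]
    rintro _ ⟨j, -, rfl⟩
    exact hsub j
  · simp only [Finset.mem_image]
    rintro _ ⟨j, -, rfl⟩
    exact hw j

/-- The assignment of goods along an assignment of turns is an allocation. -/
lemma isAllocation_image {σ : Fin m → Fin m} (hσ : Function.Bijective σ) (owner : Fin m → Fin n) :
    IsAllocation fun i => (Finset.univ.filter fun k => owner k = i).image σ where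
  disjoint i j hij := by
    rw [Finset.disjoint_left]
    simp only [Finset.mem_image, Finset.mem_filter, Finset.mem_univ, true_and]
    rintro _ ⟨k, rfl, rfl⟩ ⟨l, rfl, hl⟩
    exact hij (by rw [hσ.1 hl])
  covers g := by
    obtain ⟨k, rfl⟩ := hσ.2 g
    exact ⟨owner k, Finset.mem_image_of_mem σ (Finset.mem_filter.2 ⟨Finset.mem_univ k, rfl⟩)⟩

/-- Ranks in the ordered instance become turns: whoever holds rank `k` picks on turn `k` and gets a
good at least as valuable to her as her own good of that rank. Unassigned ranks go to agent `0`,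
which does no harm since all items are goods. -/
lemma exists_isMMSAllocation_of_canAllocate (hn : 0 < n) (hI : I.IsGoods)
    (h : CanAllocate I.scaled Finset.univ (Finset.range m)) : ∃ A, I.IsMMSAllocation A := by
  classical
  obtain ⟨B, hB, hdis⟩ := h
  have howner : ∀ k : Fin m, ∃ i : Fin n, ∀ j, k.1 ∈ B j → j = i := by
    intro k
    by_cases hk : ∃ i, k.1 ∈ B i
    · obtain ⟨i, hi⟩ := hk
      refine ⟨i, fun j hj => ?_⟩
      by_contra hne
      exact Finset.disjoint_left.1 (hdis j (Finset.mem_univ _) i (Finset.mem_univ _) hne) hj hi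
    · exact ⟨⟨0, hn⟩, fun j hj => absurd ⟨j, hj⟩ hk⟩
  choose owner howner using howner
  obtain ⟨σ, hσ, hval⟩ := I.exists_picking owner
  refine ⟨_, isAllocation_image hσ owner, fun i => ?_⟩
  by_cases hpos : 0 < I.mms i
  swap
  · exact (not_lt.1 hpos).trans (I.val_nonneg hI i _)
  obtain ⟨hsub, hw⟩ := hB i (Finset.mem_univ i)
  set T : Finset (Fin m) := Finset.univ.filter fun k => k.1 ∈ B i with hT
  have hBT : B i = T.map Fin.valEmbedding := by
    ext k
    simp only [hT, Finset.mem_map, Finset.mem_filter, Finset.mem_univ, true_and,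
      Fin.valEmbedding_apply]
    constructor
    · intro hk
      exact ⟨⟨k, Finset.mem_range.1 (hsub hk)⟩, hk, rfl⟩
    · rintro ⟨l, hl, rfl⟩
      exact hl
  rw [hBT, Finset.sum_map] at hw
  simp only [Fin.valEmbedding_apply, I.scaled_of_pos hpos] at hw
  rw [← Finset.sum_div, le_div_iff₀ hpos, one_mul] at hw
  rw [I.additive, Finset.sum_image fun a _ b _ hab => hσ.1 hab]
  calc I.mms i ≤ ∑ k ∈ T, I.val i {I.order i k} := hw
    _ ≤ ∑ k ∈ T, I.val i {σ k} := by
        refine Finset.sum_le_sum fun k hk => ?_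
        have := howner k i (Finset.mem_filter.1 hk).2
        simpa [← this] using hval k
    _ ≤ _ := by
        refine Finset.sum_le_sum_of_subset_of_nonneg (fun k hk => ?_) fun k _ _ => hI i _
        exact Finset.mem_filter.2 ⟨Finset.mem_univ _,
          (howner k i (Finset.mem_filter.1 hk).2).symm⟩

end FairInstance

theorem theorem2 (n m : ℕ) (hn : 0 < n) (hn3 : n ≠ 3) (hm : m ≤ n + 6)
    (I : FairInstance n m) (hI : I.IsGoods) :
    ∃ A : Fin n → Finset (Fin m), I.IsMMSAllocation A := by
  -- With fewer goods than agents some bundle is always empty, so no share is positive and any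
  -- allocation works.
  rcases Nat.lt_or_ge m n with hmn | hmn
  · obtain ⟨A, hA, -⟩ := I.exists_isAllocation_mms_le hn ⟨0, hn⟩
    exact ⟨A, hA, fun i => (I.mms_nonpos_of_lt hn hmn i).trans (I.val_nonneg hI i _)⟩
  · refine I.exists_isMMSAllocation_of_canAllocate hn hI
      (CanAllocate.of_card_ne_three (I.scaled_nonneg hI) (I.scaled_antitone hI) ?_ ?_ ?_)
    · simpa using hn3
    · simpa using hm
    · intro i _
      simpa using I.hasPacking_scaled hn hmn i
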